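/- Let $A$ be a locally $C^*$-algebra, i.e. a complete Hausdorff complex topological $*$-algebra (not necessarily unital) whose topology is determined by the set $S(A)$ of its continuous $C^*$-seminorms. Let $E$ be a Hilbert $A$-module (a right $A$-module with an $A$-valued inner product, linear in the second variable, complete for the seminorms $\bar p_E(\xi)=p(\langle\xi,\xi\rangle)^{1/2}$, $p\in S(A)$). For Hilbert modules $E,F$ over $A$ let $L_A(E,F)$ be the space of adjointable module morphisms $E\to F$ with the topology of the seminorms $\tilde p(T)=\sup\{\bar p_F(T\xi):\bar p_E(\xi)\le 1\}$, and let $K_A(E)$ be the closed linear span in $L_A(E)=L_A(E,E)$ of the operators $\theta_{\eta,\xi}(\zeta)=\eta\langle\xi,\zeta\rangle$, $\xi,\eta\in E$. Let $M(A)$ be the multiplier algebra of $A$: the pairs $(l,r)$ of linear maps $A\to A$ with $l(ab)=l(a)b$, $r(ab)=a\,r(b)$ and $a\,l(b)=r(a)b$, with the topology of the $C^*$-seminorms $p_{M(A)}(l,r)=\sup\{p(l(a)):p(a)\le1\}$, $p\in S(A)$; it is identified with $L_A(A)$ through $(l,r)\mapsto l$. Let $M(E)=L_A(A,E)$ be the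 multiplier module of $E$, a Hilbert $M(A)$-module with action $t\cdot m=t\circ m$ and inner product $\langle s,t\rangle=s^*\circ t$; $K_{M(A)}(M(E))\subseteq L_{M(A)}(M(E))$ is defined as above, with the seminorms $p_{M(A)}$, $p\in S(A)$, in place of $p$. Then $K_A(E)$ and $K_{M(A)}(M(E))$ are $*$-subalgebras of $L_A(E)$ and $L_{M(A)}(M(E))$, and there are a closed two-sided $*$-ideal $I$ of $K_{M(A)}(M(E))$ which is essential (if $k\in K_{M(A)}(M(E))$ and $kI=0$ or $Ik=0$, then $k=0$) and a $*$-algebra isomorphism $K_A(E)\to I$ that is a homeomorphism. -/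

import Mathlib

open Filter Topology

/-! ## Locally C*-algebras -/

/-- A continuous C*-seminorm on a topological `*`-algebra `A`; the type of all of them is `S(A)`. -/
structure ContCStarSeminorm (A : Type*) [NonUnitalRing A] [StarRing A] [Module ℂ A]
    [TopologicalSpace A] extends Seminorm ℂ A where
  mul_le' : ∀ a b : A, toFun (a * b) ≤ toFun a * toFun b
  star_mul_self' : ∀ a : A, toFun (star a * a) = toFun a ^ 2
  continuous' : Continuous toFun

/-- A locally C*-algebra: a complete Hausdorff complex topological `*`-algebra (not necessarily
unital) whose topology is determined by its continuous C*-seminorms, i.e. a net converges to `0`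
if and only if its image under each continuous C*-seminorm converges to `0`. -/
class LocallyCStarAlgebra (A : Type*) [NonUnitalRing A] [StarRing A] [Module ℂ A]
    [IsScalarTower ℂ A A] [SMulCommClass ℂ A A] [StarModule ℂ A] [UniformSpace A] : Prop extends
    IsUniformAddGroup A, ContinuousSMul ℂ A, ContinuousMul A, ContinuousStar A, T2Space A,
    CompleteSpace A where
  le_nhds_zero_iff : ∀ f : Filter A,
    f ≤ 𝓝 0 ↔ ∀ p : ContCStarSeminorm A, Tendsto (fun a => p.toSeminorm a) f (𝓝 0)

/-- A family of real-valued functions on `B` (in all uses: C*-seminorms) chosen to define the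
topology of `B`. It is instantiated below for a locally C*-algebra `A`, by all of its continuous
C*-seminorms, and for the multiplier algebra of `A`. -/
class DefiningSeminorms (B : Type*) where
  family : Set (B → ℝ)

instance ContCStarSeminorm.definingSeminorms (A : Type*) [NonUnitalRing A] [StarRing A]
    [Module ℂ A] [TopologicalSpace A] : DefiningSeminorms A where
  family := Set.range fun p : ContCStarSeminorm A => fun a => p.toSeminorm a

/-! ## Hilbert modules -/

/-- A complex vector space `E` that is a right `A`-module (with action `act ξ a = ξ a`), compatibly
with the complex structure, and has an `A`-valued hermitian form `ip ξ η = ⟨ξ, η⟩`, which is `ℂ`- and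
`A`-linear in the second variable. Positivity and definiteness are in `IsHilbertModule`. -/
class InnerModule (A E : Type*) [NonUnitalRing A] [StarRing A] [Module ℂ A]
    [AddCommGroup E] [Module ℂ E] where
  act : E → A → E
  add_act : ∀ (ξ η : E) (a : A), act (ξ + η) a = act ξ a + act η a
  act_add : ∀ (ξ : E) (a b : A), act ξ (a + b) = act ξ a + act ξ b
  act_mul : ∀ (ξ : E) (a b : A), act ξ (a * b) = act (act ξ a) b
  smul_act : ∀ (c : ℂ) (ξ : E) (a : A), act (c • ξ) a = c • act ξ a
  act_smul : ∀ (c : ℂ) (ξ : E) (a : A), act ξ (c • a) = c • act ξ a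
  ip : E → E → A
  ip_add : ∀ ξ η ζ : E, ip ξ (η + ζ) = ip ξ η + ip ξ ζ
  ip_smul : ∀ (c : ℂ) (ξ η : E), ip ξ (c • η) = c • ip ξ η
  ip_act : ∀ (ξ η : E) (a : A), ip ξ (act η a) = ip ξ η * a
  star_ip : ∀ ξ η : E, star (ip ξ η) = ip η ξ

open InnerModule

/-- `p̄(ξ) = √p(⟨ξ, ξ⟩)`. -/
noncomputable def modSeminorm {A E : Type*} [NonUnitalRing A] [StarRing A] [Module ℂ A]
    [AddCommGroup E] [Module ℂ E] [InnerModule A E] (p : A → ℝ) (ξ : E) : ℝ :=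
  √(p (ip ξ ξ))

/-- `E` is a Hilbert `A`-module: the form is positive (`a ≥ 0` means `a = b* b` for some `b`) and
definite, and every Cauchy filter (equivalently, net) for the seminorms `p̄` converges. -/
class IsHilbertModule (A E : Type*) [NonUnitalRing A] [StarRing A] [Module ℂ A]
    [DefiningSeminorms A] [AddCommGroup E] [Module ℂ E] [InnerModule A E] : Prop where
  ip_self_nonneg : ∀ ξ : E, ∃ b : A, ip ξ ξ = star b * b
  ip_self_eq_zero : ∀ ξ : E, (ip ξ ξ : A) = 0 ↔ ξ = 0
  complete : ∀ f : Filter E, f.NeBot →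
    (∀ p ∈ DefiningSeminorms.family (B := A), ∀ ε > 0, ∃ s ∈ f, ∀ ξ ∈ s, ∀ η ∈ s,
      modSeminorm p (ξ - η) < ε) →
    ∃ ζ : E, ∀ p ∈ DefiningSeminorms.family (B := A), ∀ ε > 0, ∀ᶠ ξ in f, modSeminorm p (ξ - ζ) < ε

/-- A locally C*-algebra as a right module over itself, with `⟨a, b⟩ = a* b`. -/
instance InnerModule.self (A : Type*) [NonUnitalRing A] [StarRing A] [Module ℂ A]
    [IsScalarTower ℂ A A] [SMulCommClass ℂ A A] : InnerModule A A where
  act a b := a * b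
  add_act _ _ _ := add_mul _ _ _
  act_add _ _ _ := mul_add _ _ _
  act_mul _ _ _ := (mul_assoc _ _ _).symm
  smul_act _ _ _ := smul_mul_assoc _ _ _
  act_smul _ _ _ := mul_smul_comm _ _ _
  ip a b := star a * b
  ip_add _ _ _ := mul_add _ _ _
  ip_smul _ _ _ := mul_smul_comm _ _ _
  ip_act _ _ _ := (mul_assoc _ _ _).symm
  star_ip a b := by simp

/-! ## Adjointable operators -/

/-- `L_A(E, F)`: the adjointable module morphisms `E → F`, each bundled with its adjoint (which is
unique, as the form of a Hilbert module is definite). -/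
structure Adj (A E F : Type*) [NonUnitalRing A] [StarRing A] [Module ℂ A]
    [AddCommGroup E] [Module ℂ E] [InnerModule A E]
    [AddCommGroup F] [Module ℂ F] [InnerModule A F] where
  map : E →ₗ[ℂ] F
  adj : F →ₗ[ℂ] E
  map_act : ∀ (ξ : E) (a : A), map (act ξ a) = act (map ξ) a
  adj_act : ∀ (η : F) (a : A), adj (act η a) = act (adj η) a
  ip_map : ∀ (ξ : E) (η : F), (ip (map ξ) η : A) = ip ξ (adj η)

namespace InnerModule

variable {A E : Type*} [NonUnitalRing A] [StarRing A] [Module ℂ A]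
  [AddCommGroup E] [Module ℂ E] [InnerModule A E]

theorem add_ip (ξ η ζ : E) : (ip (ξ + η) ζ : A) = ip ξ ζ + ip η ζ := by
  rw [← star_ip, ip_add, star_add, star_ip, star_ip]

theorem smul_ip [StarModule ℂ A] (c : ℂ) (ξ η : E) :
    (ip (c • ξ) η : A) = star c • ip ξ η := by
  rw [← star_ip, ip_smul, star_smul, star_ip]

theorem act_ip (ξ η : E) (a : A) : (ip (act ξ a) η : A) = star a * ip ξ η := by
  rw [← star_ip, ip_act, star_mul, star_ip]

theorem zero_act (a : A) : act (0 : E) a = 0 := by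
  have := smul_act (0 : ℂ) (0 : E) a
  simpa using this

theorem neg_act (ξ : E) (a : A) : act (-ξ) a = -act ξ a := by
  have := smul_act (-1 : ℂ) ξ a
  simpa using this

theorem ip_zero (ξ : E) : (ip ξ (0 : E) : A) = 0 := by
  have := ip_smul (A := A) (0 : ℂ) ξ 0
  simpa using this

theorem zero_ip (ξ : E) : (ip (0 : E) ξ : A) = 0 := by
  rw [← star_ip, ip_zero, star_zero]

theorem ip_neg (ξ η : E) : (ip ξ (-η) : A) = -ip ξ η := by
  have := ip_smul (A := A) (-1 : ℂ) ξ η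
  simpa using this

theorem neg_ip (ξ η : E) : (ip (-ξ) η : A) = -ip ξ η := by
  rw [← star_ip, ip_neg, star_neg, star_ip]

end InnerModule

namespace Adj

variable {A E F G : Type*} [NonUnitalRing A] [StarRing A] [Module ℂ A]
  [AddCommGroup E] [Module ℂ E] [InnerModule A E]
  [AddCommGroup F] [Module ℂ F] [InnerModule A F]
  [AddCommGroup G] [Module ℂ G] [InnerModule A G]

@[ext]
theorem ext {S T : Adj A E F} (h : ∀ ξ, S.map ξ = T.map ξ) (h' : ∀ η, S.adj η = T.adj η) :
    S = T := by
  cases S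
  cases T
  congr
  · exact LinearMap.ext h
  · exact LinearMap.ext h'

/-- `T ↦ T*`. -/
def adjoint (T : Adj A E F) : Adj A F E where
  map := T.adj
  adj := T.map
  map_act := T.adj_act
  adj_act := T.map_act
  ip_map η ξ := by rw [← star_ip, ← T.ip_map, star_ip]

/-- `S ∘ T`. -/
def comp (S : Adj A F G) (T : Adj A E F) : Adj A E G where
  map := S.map ∘ₗ T.map
  adj := T.adj ∘ₗ S.adj
  map_act ξ a := by simp [S.map_act, T.map_act]
  adj_act ξ a := by simp [S.adj_act, T.adj_act]
  ip_map ξ η := by simp [S.ip_map, T.ip_map]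

instance : Zero (Adj A E F) where
  zero :=
    { map := 0
      adj := 0
      map_act := fun _ _ => by simp [zero_act]
      adj_act := fun _ _ => by simp [zero_act]
      ip_map := fun _ _ => by simp [zero_ip, ip_zero] }

instance : Add (Adj A E F) where
  add S T :=
    { map := S.map + T.map
      adj := S.adj + T.adj
      map_act := fun _ _ => by simp [S.map_act, T.map_act, add_act]
      adj_act := fun _ _ => by simp [S.adj_act, T.adj_act, add_act]
      ip_map := fun _ _ => by simp [S.ip_map, T.ip_map, ip_add, add_ip] }

instance : Neg (Adj A E F) where
  neg S :=
    { map := -S.map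
      adj := -S.adj
      map_act := fun _ _ => by simp [S.map_act, neg_act]
      adj_act := fun _ _ => by simp [S.adj_act, neg_act]
      ip_map := fun _ _ => by simp [S.ip_map, ip_neg, neg_ip] }

instance [StarModule ℂ A] : SMul ℂ (Adj A E F) where
  smul c S :=
    { map := c • S.map
      adj := star c • S.adj
      map_act := fun _ _ => by simp [S.map_act, smul_act]
      adj_act := fun _ _ => by simp [S.adj_act, smul_act]
      ip_map := fun _ _ => by simp [S.ip_map, smul_ip, ip_smul] }

@[simp] theorem zero_map (ξ : E) : (0 : Adj A E F).map ξ = 0 := rfl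
@[simp] theorem zero_adj (η : F) : (0 : Adj A E F).adj η = 0 := rfl
@[simp] theorem add_map (S T : Adj A E F) (ξ : E) : (S + T).map ξ = S.map ξ + T.map ξ := rfl
@[simp] theorem add_adj (S T : Adj A E F) (η : F) : (S + T).adj η = S.adj η + T.adj η := rfl
@[simp] theorem neg_map (S : Adj A E F) (ξ : E) : (-S).map ξ = -S.map ξ := rfl
@[simp] theorem neg_adj (S : Adj A E F) (η : F) : (-S).adj η = -S.adj η := rfl
@[simp] theorem smul_map [StarModule ℂ A] (c : ℂ) (S : Adj A E F) (ξ : E) :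
    (c • S).map ξ = c • S.map ξ := rfl
@[simp] theorem smul_adj [StarModule ℂ A] (c : ℂ) (S : Adj A E F) (η : F) :
    (c • S).adj η = star c • S.adj η := rfl
@[simp] theorem comp_map (S : Adj A F G) (T : Adj A E F) (ξ : E) :
    (S.comp T).map ξ = S.map (T.map ξ) := rfl
@[simp] theorem comp_adj (S : Adj A F G) (T : Adj A E F) (ζ : G) :
    (S.comp T).adj ζ = T.adj (S.adj ζ) := rfl
@[simp] theorem adjoint_map (T : Adj A E F) (η : F) : T.adjoint.map η = T.adj η := rfl
@[simp] theorem adjoint_adj (T : Adj A E F) (ξ : E) : T.adjoint.adj ξ = T.map ξ := rfl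

instance : AddCommGroup (Adj A E F) where
  add_assoc _ _ _ := by ext <;> simp [add_assoc]
  zero_add _ := by ext <;> simp
  add_zero _ := by ext <;> simp
  add_comm _ _ := by ext <;> simp [add_comm]
  neg_add_cancel _ := by ext <;> simp
  nsmul := nsmulRec
  zsmul := zsmulRec

instance [StarModule ℂ A] : Module ℂ (Adj A E F) where
  one_smul _ := by ext <;> simp
  mul_smul _ _ _ := by ext <;> simp [mul_smul]
  smul_zero _ := by ext <;> simp
  smul_add _ _ _ := by ext <;> simp
  add_smul _ _ _ := by ext <;> simp [add_smul]
  zero_smul _ := by ext <;> simp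

instance : Ring (Adj A E E) where
  __ := (inferInstance : AddCommGroup (Adj A E E))
  mul S T := S.comp T
  one :=
    { map := LinearMap.id
      adj := LinearMap.id
      map_act := fun _ _ => rfl
      adj_act := fun _ _ => rfl
      ip_map := fun _ _ => rfl }
  left_distrib S T U := Adj.ext (fun ξ => S.map.map_add _ _) (fun _ => rfl)
  right_distrib S T U := Adj.ext (fun _ => rfl) (fun ξ => U.adj.map_add _ _)
  zero_mul S := Adj.ext (fun _ => rfl) (fun _ => S.adj.map_zero)
  mul_zero S := Adj.ext (fun _ => S.map.map_zero) (fun _ => rfl)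
  mul_assoc _ _ _ := rfl
  one_mul _ := rfl
  mul_one _ := rfl

@[simp] theorem mul_map (S T : Adj A E E) (ξ : E) : (S * T).map ξ = S.map (T.map ξ) := rfl
@[simp] theorem mul_adj (S T : Adj A E E) (ξ : E) : (S * T).adj ξ = T.adj (S.adj ξ) := rfl

instance : StarRing (Adj A E E) where
  star T := T.adjoint
  star_involutive _ := rfl
  star_mul _ _ := rfl
  star_add _ _ := rfl

instance [StarModule ℂ A] : IsScalarTower ℂ (Adj A E E) (Adj A E E) where
  smul_assoc c S T := by ext <;> simp

instance [StarModule ℂ A] : SMulCommClass ℂ (Adj A E E) (Adj A E E) where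
  smul_comm c S T := by ext <;> simp

instance [StarModule ℂ A] : StarModule ℂ (Adj A E E) where
  star_smul c S := Adj.ext (fun _ => rfl) (fun ξ => by
    change c • S.map ξ = star (star c) • S.map ξ
    rw [star_star])

/-- `p̃(T) = sup {p̄(T ξ) ; p̄(ξ) ≤ 1}`. For Hilbert modules over a locally C*-algebra this supremum
is finite. -/
noncomputable def opSeminorm (p : A → ℝ) (T : Adj A E F) : ℝ :=
  sSup {r : ℝ | ∃ ξ : E, modSeminorm p ξ ≤ 1 ∧ r = modSeminorm p (T.map ξ)}

/-- The topology of `L_A(E, F)`, defined by the seminorms `p̃`: it is generated by their balls. -/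
instance [DefiningSeminorms A] : TopologicalSpace (Adj A E F) :=
  TopologicalSpace.generateFrom {U | ∃ p ∈ DefiningSeminorms.family (B := A), ∃ T : Adj A E F,
    ∃ ε : ℝ, U = {S | opSeminorm p (S - T) < ε}}

/-- The rank one operator `θ_{η,ξ} : ζ ↦ η ⟨ξ, ζ⟩`, with adjoint `θ_{ξ,η}`. -/
def rankOne (η : F) (ξ : E) : Adj A E F where
  map :=
    { toFun := fun ζ => act η (ip ξ ζ : A)
      map_add' := fun _ _ => by rw [ip_add, act_add]
      map_smul' := fun _ _ => by rw [ip_smul, act_smul]; rfl }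
  adj :=
    { toFun := fun ζ => act ξ (ip η ζ : A)
      map_add' := fun _ _ => by rw [ip_add, act_add]
      map_smul' := fun _ _ => by rw [ip_smul, act_smul]; rfl }
  map_act _ _ := by simp [ip_act, act_mul]
  adj_act _ _ := by simp [ip_act, act_mul]
  ip_map _ _ := by simp [ip_act, act_ip, star_ip]

end Adj

/-- The set of "compact" operators `K_A(E)`: the closed linear span in `L_A(E)` of the rank one
operators. -/
def compactOperators (A E : Type*) [NonUnitalRing A] [StarRing A] [Module ℂ A] [StarModule ℂ A]
    [DefiningSeminorms A] [AddCommGroup E] [Module ℂ E] [InnerModule A E] : Set (Adj A E E) :=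
  closure (Submodule.span ℂ {T : Adj A E E | ∃ η ξ : E, T = Adj.rankOne η ξ} : Set (Adj A E E))

/-! ## Multiplier algebra -/

/-- The multiplier algebra `M(A)`: pairs `(l, r)` of linear maps `A → A` with `l(ab) = l(a)b`,
`r(ab) = a r(b)` and `a l(b) = r(a) b`. -/
structure MultAlg (A : Type*) [NonUnitalRing A] [Module ℂ A] where
  l : A →ₗ[ℂ] A
  r : A →ₗ[ℂ] A
  l_mul : ∀ a b : A, l (a * b) = l a * b
  r_mul : ∀ a b : A, r (a * b) = a * r b
  mul_l : ∀ a b : A, a * l b = r a * b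

namespace MultAlg

/-- For a linear map `f : A → A`, the linear map `a ↦ f(a*)*`. -/
def conj {A : Type*} [NonUnitalRing A] [Module ℂ A] [StarRing A] [StarModule ℂ A]
    (f : A →ₗ[ℂ] A) : A →ₗ[ℂ] A where
  toFun a := star (f (star a))
  map_add' _ _ := by simp
  map_smul' _ _ := by simp

@[simp] theorem conj_apply {A : Type*} [NonUnitalRing A] [Module ℂ A] [StarRing A]
    [StarModule ℂ A] (f : A →ₗ[ℂ] A) (a : A) : conj f a = star (f (star a)) := rfl

variable {A : Type*} [NonUnitalRing A] [Module ℂ A]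

@[ext]
theorem ext {m n : MultAlg A} (h : ∀ a, m.l a = n.l a) (h' : ∀ a, m.r a = n.r a) : m = n := by
  cases m
  cases n
  congr
  · exact LinearMap.ext h
  · exact LinearMap.ext h'

instance : Zero (MultAlg A) where
  zero := ⟨0, 0, by simp, by simp, by simp⟩

instance : Add (MultAlg A) where
  add m n := ⟨m.l + n.l, m.r + n.r, by simp [m.l_mul, n.l_mul, add_mul],
    by simp [m.r_mul, n.r_mul, mul_add], by simp [m.mul_l, n.mul_l, mul_add, add_mul]⟩

instance : Neg (MultAlg A) where
  neg m := ⟨-m.l, -m.r, by simp [m.l_mul], by simp [m.r_mul], by simp [m.mul_l]⟩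

instance [IsScalarTower ℂ A A] [SMulCommClass ℂ A A] : SMul ℂ (MultAlg A) where
  smul c m := ⟨c • m.l, c • m.r, by simp [m.l_mul, smul_mul_assoc],
    by simp [m.r_mul, mul_smul_comm], by simp [m.mul_l, smul_mul_assoc, mul_smul_comm]⟩

@[simp] theorem zero_l (a : A) : (0 : MultAlg A).l a = 0 := rfl
@[simp] theorem zero_r (a : A) : (0 : MultAlg A).r a = 0 := rfl
@[simp] theorem add_l (m n : MultAlg A) (a : A) : (m + n).l a = m.l a + n.l a := rfl
@[simp] theorem add_r (m n : MultAlg A) (a : A) : (m + n).r a = m.r a + n.r a := rfl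
@[simp] theorem neg_l (m : MultAlg A) (a : A) : (-m).l a = -m.l a := rfl
@[simp] theorem neg_r (m : MultAlg A) (a : A) : (-m).r a = -m.r a := rfl

instance : AddCommGroup (MultAlg A) where
  add_assoc _ _ _ := by ext <;> simp [add_assoc]
  zero_add _ := by ext <;> simp
  add_zero _ := by ext <;> simp
  add_comm _ _ := by ext <;> simp [add_comm]
  neg_add_cancel _ := by ext <;> simp
  nsmul := nsmulRec
  zsmul := zsmulRec

/-- The product is `(l, r) (l', r') = (l ∘ l', r' ∘ r)`. -/
instance : Ring (MultAlg A) where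
  __ := (inferInstance : AddCommGroup (MultAlg A))
  mul m n := ⟨m.l ∘ₗ n.l, n.r ∘ₗ m.r, by simp [m.l_mul, n.l_mul], by simp [m.r_mul, n.r_mul],
    by simp [m.mul_l, n.mul_l]⟩
  one := ⟨LinearMap.id, LinearMap.id, fun _ _ => rfl, fun _ _ => rfl, fun _ _ => rfl⟩
  left_distrib m _ _ := MultAlg.ext (fun _ => m.l.map_add _ _) (fun _ => rfl)
  right_distrib _ _ k := MultAlg.ext (fun _ => rfl) (fun _ => k.r.map_add _ _)
  zero_mul m := MultAlg.ext (fun _ => rfl) (fun _ => m.r.map_zero)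
  mul_zero m := MultAlg.ext (fun _ => m.l.map_zero) (fun _ => rfl)
  mul_assoc _ _ _ := rfl
  one_mul _ := rfl
  mul_one _ := rfl

@[simp] theorem mul_l' (m n : MultAlg A) (a : A) : (m * n).l a = m.l (n.l a) := rfl
@[simp] theorem mul_r' (m n : MultAlg A) (a : A) : (m * n).r a = n.r (m.r a) := rfl

section Involution

variable [StarRing A] [StarModule ℂ A]

/-- The involution is `(l, r)* = (a ↦ r(a*)*, a ↦ l(a*)*)`. -/
instance : StarRing (MultAlg A) where
  star m := ⟨conj m.r, conj m.l, by simp [m.r_mul], by simp [m.l_mul],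
    fun a b => by
      apply star_injective
      simp [m.mul_l]⟩
  star_involutive m := by
    apply MultAlg.ext <;> intro a <;> simp
  star_mul m n := by
    apply MultAlg.ext <;> intro a <;> simp
  star_add m n := by
    apply MultAlg.ext <;> intro a <;> simp

@[simp] theorem star_l (m : MultAlg A) (a : A) : (star m).l a = star (m.r (star a)) := rfl
@[simp] theorem star_r (m : MultAlg A) (a : A) : (star m).r a = star (m.l (star a)) := rfl

end Involution

variable [IsScalarTower ℂ A A] [SMulCommClass ℂ A A]

@[simp] theorem smul_l (c : ℂ) (m : MultAlg A) (a : A) : (c • m).l a = c • m.l a := rfl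
@[simp] theorem smul_r (c : ℂ) (m : MultAlg A) (a : A) : (c • m).r a = c • m.r a := rfl

instance : Module ℂ (MultAlg A) where
  one_smul _ := by ext <;> simp
  mul_smul _ _ _ := by ext <;> simp [mul_smul]
  smul_zero _ := by ext <;> simp
  smul_add _ _ _ := by ext <;> simp
  add_smul _ _ _ := by ext <;> simp [add_smul]
  zero_smul _ := by ext <;> simp

instance : IsScalarTower ℂ (MultAlg A) (MultAlg A) where
  smul_assoc _ _ _ := by ext <;> simp

instance : SMulCommClass ℂ (MultAlg A) (MultAlg A) where
  smul_comm _ _ _ := by ext <;> simp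

variable [StarRing A] [StarModule ℂ A]

instance : StarModule ℂ (MultAlg A) where
  star_smul _ _ := by ext <;> simp

/-- The left multiplication `l` of a multiplier `(l, r)`, as an adjointable operator on `A`. -/
def toAdj (m : MultAlg A) : Adj A A A where
  map := m.l
  adj := conj m.r
  map_act := m.l_mul
  adj_act a b := by simp [act, m.r_mul]
  ip_map a b := by
    change star (m.l a) * b = star a * star (m.r (star b))
    rw [← star_mul, ← m.mul_l, star_mul, star_star]

/-- The multiplier `(T, a ↦ (T* a*)*)` given by an adjointable operator `T` on `A`; this is the
inverse of `toAdj` and so identifies `L_A(A)` with `M(A)`. -/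
def ofAdj (T : Adj A A A) : MultAlg A where
  l := T.map
  r := conj T.adj
  l_mul := T.map_act
  r_mul a b := by
    have := T.adj_act (star b) (star a)
    simp only [act] at this
    simp [this]
  mul_l a b := by
    have := T.ip_map b (star a)
    simp only [ip] at this
    apply star_injective
    simpa using this

theorem ofAdj_toAdj (m : MultAlg A) : ofAdj m.toAdj = m := by
  ext <;> simp [ofAdj, toAdj]

theorem toAdj_ofAdj (T : Adj A A A) : (ofAdj T).toAdj = T := by
  ext <;> simp [ofAdj, toAdj]

/-- `p_{M(A)}(l, r) = sup {p(l(a)) ; p(a) ≤ 1}`. For a continuous C*-seminorm `p` on a locally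
C*-algebra this supremum is finite. -/
noncomputable def seminorm (p : A → ℝ) (m : MultAlg A) : ℝ :=
  sSup {x : ℝ | ∃ a : A, p a ≤ 1 ∧ x = p (m.l a)}

/-- The topology of `M(A)` is defined by the seminorms `p_{M(A)}`, with `p` in `S(A)`. -/
noncomputable instance [TopologicalSpace A] : DefiningSeminorms (MultAlg A) where
  family := {P | ∃ p : ContCStarSeminorm A, P = seminorm fun a => p.toSeminorm a}

end MultAlg

/-! ## Multiplier module -/

/-- The multiplier module `M(E) = L_A(A, E)`. -/
abbrev MultMod (A E : Type*) [NonUnitalRing A] [StarRing A] [Module ℂ A] [IsScalarTower ℂ A A]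
    [SMulCommClass ℂ A A] [AddCommGroup E] [Module ℂ E] [InnerModule A E] : Type _ :=
  Adj A A E

/-- The right `M(A)`-module structure `t · m = t ∘ m` of `M(E)` and its `M(A)`-valued inner product
`⟨s, t⟩ = s* ∘ t`, where `M(A)` is identified with `L_A(A)`. -/
instance MultMod.innerModule (A E : Type*) [NonUnitalRing A] [StarRing A] [Module ℂ A]
    [IsScalarTower ℂ A A] [SMulCommClass ℂ A A] [StarModule ℂ A] [AddCommGroup E] [Module ℂ E]
    [InnerModule A E] : InnerModule (MultAlg A) (MultMod A E) where
  act t m := t.comp m.toAdj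
  add_act _ _ _ := by ext <;> simp [MultAlg.toAdj]
  act_add _ _ _ := by ext <;> simp [MultAlg.toAdj]
  act_mul _ _ _ := by ext <;> simp [MultAlg.toAdj]
  smul_act _ _ _ := by ext <;> simp [MultAlg.toAdj]
  act_smul _ _ _ := by ext <;> simp [MultAlg.toAdj]
  ip s t := MultAlg.ofAdj (s.adjoint.comp t)
  ip_add _ _ _ := by ext <;> simp [MultAlg.ofAdj]
  ip_smul _ _ _ := by ext <;> simp [MultAlg.ofAdj]
  ip_act _ _ _ := by ext <;> simp [MultAlg.ofAdj, MultAlg.toAdj]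
  star_ip _ _ := by ext <;> simp [MultAlg.ofAdj]

/-! ## Essential ideals -/

/-- `I` is an essential (closed, two-sided, `*`-closed) ideal of the `*`-subalgebra `K` of `L`: only
the zero element of `K` annihilates `I` from the left, or from the right. -/
structure IsEssentialIdeal {L : Type*} [Ring L] [StarRing L] [Module ℂ L] [TopologicalSpace L]
    (I K : NonUnitalStarSubalgebra ℂ L) : Prop where
  le : I ≤ K
  isClosed : IsClosed (I : Set L)
  mul_mem_left : ∀ k ∈ K, ∀ x ∈ I, k * x ∈ I
  mul_mem_right : ∀ k ∈ K, ∀ x ∈ I, x * k ∈ I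
  left_annihilator : ∀ k ∈ K, (∀ x ∈ I, k * x = 0) → k = 0
  right_annihilator : ∀ k ∈ K, (∀ x ∈ I, x * k = 0) → k = 0

/-! Let Φ (`leftComp`) send T ∈ L_A(E) to the operator s ↦ T ∘ s on M(E). It is a `*`-isomorphism of
L_A(E) onto L_{M(A)}(M(E)) that preserves every operator seminorm (`opSeminorm_leftComp`,
`leftComp_surjective`), so the question can be settled inside L_A(E). There θ_{s,t} on M(E) becomes
s t*, and K_{M(A)}(M(E)) becomes the closed span of all s t*. The map ξ ↦ (a ↦ ξ a) embeds E in M(E)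
and θ_{η,ξ} = η ξ*, so K_A(E) lies in that span. It is an ideal of the whole of L_A(E), and an
essential one: if k θ_{ξ,kξ} = 0, then kξ⟨kξ,kξ⟩ = 0, hence kξ = 0. The required ideal is I =
Φ(K_A(E)).

Two points are analytic. The seminorms p̃ must be finite (`Adj.exists_bound`): Banach-Steinhaus
applies on the Banach space of vectors with uniformly bounded seminorms. An operator T on M(E) must
map E into E (`exists_map_ofVector`): with s = Tξ and r = T*s one has ⟨sa, sa⟩ = ⟨ξa, ra⟩, so s
inherits the approximate units of ξ, and s is right multiplication of the vector lim s(uₙ).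

Both use the vector ξ(1 + ⟨ξ,ξ⟩)⁻¹, whose seminorms are all at most 1. Since A may lack a unit, the
inverse is written 1 - u with u in A; such a u exists by completeness (`exists_quasiInverse`). -/

namespace UniformSpace.Completion

/-! ### Completion of a `*`-algebra with a C*-seminorm. -/

section NonUnital

variable (R : Type*) [NonUnitalSeminormedRing R]

/-- The extension of the product by continuity. -/
noncomputable def mulNonUnital (x y : Completion R) : Completion R :=
  (isDenseInducing_coe.prodMap isDenseInducing_coe).extend
    (fun q : R × R => ((q.1 * q.2 : R) : Completion R)) (x, y)

variable {R}

theorem mulNonUnital_coe (a b : R) :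
    mulNonUnital R (a : Completion R) b = ((a * b : R) : Completion R) :=
  (isDenseInducing_coe.prodMap isDenseInducing_coe).extend_eq
    ((continuous_coe R).comp (continuous_mul : Continuous fun q : R × R => q.1 * q.2)) (a, b)

theorem continuous_mulNonUnital :
    Continuous fun q : Completion R × Completion R => mulNonUnital R q.1 q.2 := by
  let m := (AddMonoidHom.mul : R →+ R →+ R).compr₂ toCompl
  have : Continuous fun p : R × R => m p.1 p.2 := (continuous_coe R).comp continuous_mul
  have di : IsDenseInducing (toCompl : R → Completion R) := isDenseInducing_coe
  exact (di.extend_Z_bilin di this :)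

variable (R)

/-- The completion of a non-unital seminormed ring. It is not an instance, as it would conflict
with the one for unital rings. -/
@[reducible]
noncomputable def nonUnitalNormedRing : NonUnitalNormedRing (Completion R) :=
  let : Mul (Completion R) := ⟨mulNonUnital R⟩
  have cm : ∀ {X : Type _} [TopologicalSpace X] {f g : X → Completion R}, Continuous f →
    Continuous g → Continuous fun x => f x * g x :=
    fun hf hg => continuous_mulNonUnital.comp (hf.prodMk hg)
  have cmul : ∀ a b : R, (a : Completion R) * b = ((a * b : R) : Completion R) := mulNonUnital_coe
  { (inferInstance : NormedAddCommGroup (Completion R)) with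
    mul := mulNonUnital R
    zero_mul := fun a => Completion.induction_on a
      (isClosed_eq (cm continuous_const continuous_id) continuous_const)
      fun a => by rw [← coe_zero, cmul, zero_mul]
    mul_zero := fun a => Completion.induction_on a
      (isClosed_eq (cm continuous_id continuous_const) continuous_const)
      fun a => by rw [← coe_zero, cmul, mul_zero]
    mul_assoc := fun a b c => Completion.induction_on₃ a b c
      (isClosed_eq (cm (cm (by fun_prop) (by fun_prop)) (by fun_prop))
        (cm (by fun_prop) (cm (by fun_prop) (by fun_prop))))
      fun a b c => by rw [cmul, cmul, cmul, cmul, mul_assoc]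
    left_distrib := fun a b c => Completion.induction_on₃ a b c
      (isClosed_eq (cm (by fun_prop) (by fun_prop))
        ((cm (by fun_prop) (by fun_prop)).add (cm (by fun_prop) (by fun_prop))))
      fun a b c => by rw [← coe_add, cmul, cmul, cmul, ← coe_add, mul_add]
    right_distrib := fun a b c => Completion.induction_on₃ a b c
      (isClosed_eq (cm (by fun_prop) (by fun_prop))
        ((cm (by fun_prop) (by fun_prop)).add (cm (by fun_prop) (by fun_prop))))
      fun a b c => by rw [← coe_add, cmul, cmul, cmul, ← coe_add, add_mul]
    norm_mul_le := fun a b => Completion.induction_on₂ a b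
      (isClosed_le (cm (by fun_prop) (by fun_prop)).norm (by fun_prop))
      fun a b => by rw [cmul, norm_coe, norm_coe, norm_coe]; exact norm_mul_le a b }

variable [StarRing R] [NormedStarGroup R] [NormedSpace ℂ R] [IsScalarTower ℂ R R]
  [SMulCommClass ℂ R R] [StarModule ℂ R]

/-- The completion of a `*`-algebra with a C*-seminorm. -/
@[reducible]
noncomputable def nonUnitalCStarAlgebra (h : ∀ a : R, ‖a‖ * ‖a‖ ≤ ‖star a * a‖) :
    NonUnitalCStarAlgebra (Completion R) :=
  let := nonUnitalNormedRing R
  have cmul : ∀ a b : R, (a : Completion R) * b = ((a * b : R) : Completion R) := mulNonUnital_coe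
  have hu : UniformContinuous (star : R → R) := star_isometry.uniformContinuous
  have hs : Continuous (Completion.map (star : R → R)) := continuous_map
  have hc : ∀ a : R, Completion.map (star : R → R) (a : Completion R) = ((star a : R)) :=
    fun a => map_coe hu a
  let : StarRing (Completion R) :=
    { star := Completion.map star
      star_involutive := fun a => Completion.induction_on a
        (isClosed_eq (hs.comp hs) continuous_id) fun a => by rw [hc, hc, star_star]
      star_mul := fun a b => Completion.induction_on₂ a b
        (isClosed_eq (hs.comp (continuous_fst.mul continuous_snd))
          ((hs.comp continuous_snd).mul (hs.comp continuous_fst)))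
        fun a b => by rw [cmul, hc, hc, hc, cmul, star_mul]
      star_add := fun a b => Completion.induction_on₂ a b
        (isClosed_eq (hs.comp (continuous_fst.add continuous_snd))
          ((hs.comp continuous_fst).add (hs.comp continuous_snd)))
        fun a b => by rw [← coe_add, hc, hc, hc, ← coe_add, star_add] }
  { (inferInstance : NonUnitalNormedRing (Completion R)),
    (inferInstance : StarRing (Completion R)),
    (inferInstance : NormedSpace ℂ (Completion R)),
    (inferInstance : CompleteSpace (Completion R)) with
    norm_mul_self_le := fun a => Completion.induction_on a
      (isClosed_le (continuous_norm.mul continuous_norm) (hs.mul continuous_id).norm)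
      fun a => by
        change _ ≤ ‖Completion.map star (a : Completion R) * _‖
        rw [hc, cmul, norm_coe, norm_coe]
        exact h a
    smul_assoc := fun c a b => Completion.induction_on₂ a b
      (isClosed_eq ((continuous_fst.const_smul c).mul continuous_snd)
        ((continuous_fst.mul continuous_snd).const_smul c))
      fun a b => by
        change ((c • (a : Completion R)) * b) = c • ((a : Completion R) * b)
        rw [← coe_smul, cmul, cmul, ← coe_smul, smul_mul_assoc]
    smul_comm := fun c a b => Completion.induction_on₂ a b
      (isClosed_eq ((continuous_fst.mul continuous_snd).const_smul c)
        (continuous_fst.mul (continuous_snd.const_smul c)))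
      fun a b => by
        change c • ((a : Completion R) * b) = (a : Completion R) * (c • (b : Completion R))
        rw [← coe_smul, cmul, cmul, ← coe_smul, mul_smul_comm]
    star_smul := fun c a => Completion.induction_on a
      (isClosed_eq (hs.comp (continuous_id.const_smul c)) (hs.const_smul (star c)))
      fun a => by
        change Completion.map star (c • (a : Completion R)) =
          star c • Completion.map star (a : Completion R)
        rw [← coe_smul, hc, hc, ← coe_smul, star_smul] }

end NonUnital

end UniformSpace.Completion

/-- A `*`-algebra with a C*-seminorm maps isometrically to a C*-algebra. -/
theorem exists_cstarAlgebra_of_seminorm.{u} {A : Type u} [NonUnitalRing A] [StarRing A] [Module ℂ A]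
    [IsScalarTower ℂ A A] [SMulCommClass ℂ A A] [StarModule ℂ A] (p : Seminorm ℂ A)
    (hmul : ∀ a b : A, p (a * b) ≤ p a * p b) (hstar : ∀ a : A, p (star a * a) = p a ^ 2) :
    ∃ (B : Type u) (_ : NonUnitalCStarAlgebra B) (π : A →⋆ₙₐ[ℂ] B), ∀ a, ‖π a‖ = p a := by
  -- Cancel p(a) in p(a)² = p(a* a) ≤ p(a*) p(a).
  have hle : ∀ a : A, p a ≤ p (star a) := fun a => by
    rcases (apply_nonneg p a).eq_or_lt with h | h
    · rw [← h]; exact apply_nonneg p _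
    · refine le_of_mul_le_mul_right ?_ h
      rw [← sq, ← hstar]
      exact hmul _ _
  have hst : ∀ a : A, p (star a) = p a := fun a =>
    le_antisymm (by simpa using hle (star a)) (hle a)
  let i1 : SeminormedAddCommGroup A := p.toSeminormedAddCommGroup
  let i2 : NonUnitalSeminormedRing A :=
    { i1, (inferInstance : NonUnitalRing A) with norm_mul_le := hmul }
  let : NormedStarGroup A := ⟨fun a => (hst a).le⟩
  let : NormedSpace ℂ A := ⟨fun c a => (map_smul_eq_mul p c a).le⟩
  let j := UniformSpace.Completion.nonUnitalCStarAlgebra A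
    (fun a => by rw [← sq]; exact (hstar a).ge)
  refine ⟨UniformSpace.Completion A, j, ?_⟩
  refine ⟨{ toFun := fun a => (a : UniformSpace.Completion A)
            map_smul' := fun c a => UniformSpace.Completion.coe_smul c a
            map_zero' := UniformSpace.Completion.coe_zero
            map_add' := fun a b => UniformSpace.Completion.coe_add a b
            map_mul' := fun a b => (UniformSpace.Completion.mulNonUnital_coe a b).symm
            map_star' := fun a =>
              (UniformSpace.Completion.map_coe star_isometry.uniformContinuous a).symm }, ?_⟩
  exact fun a => UniformSpace.Completion.norm_coe a

/-! ### Continuous C*-seminorms and their representations in C*-algebras. -/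

namespace ContCStarSeminorm

section Basic

variable {A : Type*} [NonUnitalRing A] [StarRing A] [Module ℂ A] [TopologicalSpace A]
  (p : ContCStarSeminorm A)

theorem mul_le (a b : A) : p.toSeminorm (a * b) ≤ p.toSeminorm a * p.toSeminorm b :=
  p.mul_le' a b

theorem star_mul_self (a : A) : p.toSeminorm (star a * a) = p.toSeminorm a ^ 2 :=
  p.star_mul_self' a

theorem continuous : Continuous p.toSeminorm := p.continuous'

theorem star_eq (a : A) : p.toSeminorm (star a) = p.toSeminorm a := by
  have hle : ∀ a : A, p.toSeminorm a ≤ p.toSeminorm (star a) := fun a => by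
    rcases (apply_nonneg p.toSeminorm a).eq_or_lt with h | h
    · rw [← h]; exact apply_nonneg p.toSeminorm _
    · refine le_of_mul_le_mul_right ?_ h
      rw [← sq, ← p.star_mul_self]
      exact p.mul_le _ _
  exact le_antisymm (by simpa using hle (star a)) (hle a)

theorem modSeminorm_self [IsScalarTower ℂ A A] [SMulCommClass ℂ A A] (a : A) :
    modSeminorm (A := A) p.toSeminorm a = p.toSeminorm a := by
  change √(p.toSeminorm (star a * a)) = _
  rw [p.star_mul_self, Real.sqrt_sq (apply_nonneg _ _)]

/-- Nonemptiness of S(A) is needed for the basis of neighbourhoods of 0 and for suprema over S(A).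
-/
noncomputable instance : Inhabited (ContCStarSeminorm A) :=
  ⟨{ (0 : Seminorm ℂ A) with
      mul_le' := fun _ _ => (mul_zero (0 : ℝ)).ge
      star_mul_self' := fun _ => (zero_pow two_ne_zero).symm
      continuous' := continuous_const }⟩

/-- The pointwise maximum of two continuous C*-seminorms. -/
noncomputable instance : Max (ContCStarSeminorm A) where
  max p q :=
    { p.toSeminorm ⊔ q.toSeminorm with
      mul_le' := fun a b => by
        change max _ _ ≤ max _ _ * max _ _
        refine max_le ((p.mul_le a b).trans ?_) ((q.mul_le a b).trans ?_)
        · exact mul_le_mul (le_max_left _ _) (le_max_left _ _) (apply_nonneg _ _)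
            (le_max_of_le_left (apply_nonneg _ _))
        · exact mul_le_mul (le_max_right _ _) (le_max_right _ _) (apply_nonneg _ _)
            (le_max_of_le_left (apply_nonneg _ _))
      star_mul_self' := fun a => by
        change max (p.toSeminorm _) (q.toSeminorm _) = max (p.toSeminorm a) (q.toSeminorm a) ^ 2
        rw [p.star_mul_self, q.star_mul_self]
        rcases le_total (p.toSeminorm a) (q.toSeminorm a) with h | h
        · rw [max_eq_right h, max_eq_right (pow_le_pow_left₀ (apply_nonneg _ _) h 2)]
        · rw [max_eq_left h, max_eq_left (pow_le_pow_left₀ (apply_nonneg _ _) h 2)]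
      continuous' := p.continuous.max q.continuous }

theorem le_max_left (p q : ContCStarSeminorm A) (a : A) :
    p.toSeminorm a ≤ (max p q).toSeminorm a := _root_.le_max_left _ _

theorem le_max_right (p q : ContCStarSeminorm A) (a : A) :
    q.toSeminorm a ≤ (max p q).toSeminorm a := _root_.le_max_right _ _

end Basic

end ContCStarSeminorm

/-- A `*`-algebra with a continuous C*-seminorm maps isometrically to an ordered unital
C*-algebra. -/
theorem exists_ordered_cstarAlgebra.{u} {A : Type u} [NonUnitalRing A] [StarRing A] [Module ℂ A]
    [IsScalarTower ℂ A A] [SMulCommClass ℂ A A] [StarModule ℂ A] [TopologicalSpace A]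
    (p : ContCStarSeminorm A) :
    ∃ (C : Type u) (_ : CStarAlgebra C) (_ : PartialOrder C) (_ : StarOrderedRing C)
      (π : A →⋆ₙₐ[ℂ] C), ∀ a, ‖π a‖ = p.toSeminorm a := by
  obtain ⟨B, _, π, hπ⟩ := exists_cstarAlgebra_of_seminorm p.toSeminorm p.mul_le p.star_mul_self
  let := CStarAlgebra.spectralOrder (Unitization ℂ B)
  refine ⟨Unitization ℂ B, inferInstance, inferInstance, CStarAlgebra.spectralOrderedRing _,
    (Unitization.inrNonUnitalStarAlgHom ℂ B).comp π, fun a => ?_⟩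
  rw [← hπ]
  exact Unitization.norm_inr (𝕜 := ℂ) (π a)

/-! ### Order estimates for 1 + a with a ≥ 0. -/

section CStarAlgebra

variable {C : Type*} [CStarAlgebra C] [PartialOrder C] [StarOrderedRing C]

/-- An inequality rather than an equality, so that the zero algebra is included. -/
theorem norm_one_le_one (C : Type*) [CStarAlgebra C] : ‖(1 : C)‖ ≤ 1 := by
  have := CStarRing.norm_star_mul_self (x := (1 : C))
  rw [star_one, one_mul] at this
  by_contra! h
  nlinarith

theorem norm_algebraMap_sub_le {a : C} (ha : 0 ≤ a) {N : ℝ} (hN : ‖a‖ ≤ N) :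
    ‖algebraMap ℝ C N - a‖ ≤ N := by
  have h0 : 0 ≤ N := (norm_nonneg a).trans hN
  have h1 : a ≤ algebraMap ℝ C N := (CStarAlgebra.norm_le_iff_le_algebraMap a h0 ha).1 hN
  rw [CStarAlgebra.norm_le_iff_le_algebraMap _ h0 (sub_nonneg.2 h1)]
  exact sub_le_self _ ha

/-- Expand (1 + a)² = 1 + 2a + a² and drop the positive terms other than 1; the next lemma keeps one
copy of a instead. -/
theorem star_mul_self_le_one_add_conj {a : C} (ha : 0 ≤ a) (x : C) :
    star x * x ≤ star ((1 + a) * x) * ((1 + a) * x) := by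
  have hs : star a = a := ha.isSelfAdjoint
  have : star ((1 + a) * x) * ((1 + a) * x) =
      star x * x + (star x * a * x + star x * a * x + star (a * x) * (a * x)) := by
    simp only [star_mul, star_add, star_one, hs]; noncomm_ring
  rw [this]
  have h1 := star_left_conjugate_nonneg ha x
  exact le_add_of_nonneg_right (add_nonneg (add_nonneg h1 h1) (star_mul_self_nonneg _))

theorem conj_le_one_add_conj {a : C} (ha : 0 ≤ a) (x : C) :
    star x * a * x ≤ star ((1 + a) * x) * ((1 + a) * x) := by
  have hs : star a = a := ha.isSelfAdjoint
  have : star ((1 + a) * x) * ((1 + a) * x) =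
      star x * a * x + (star x * x + star x * a * x + star (a * x) * (a * x)) := by
    simp only [star_mul, star_add, star_one, hs]; noncomm_ring
  rw [this]
  have h1 := star_left_conjugate_nonneg ha x
  exact le_add_of_nonneg_right (add_nonneg (add_nonneg (star_mul_self_nonneg _) h1)
    (star_mul_self_nonneg _))

/-- Left multiplication by 1 + a does not shrink norms; in particular an inverse of 1 + a has norm
at most 1. -/
theorem norm_le_norm_one_add_mul {a : C} (ha : 0 ≤ a) (x : C) : ‖x‖ ≤ ‖(1 + a) * x‖ := by
  have := CStarAlgebra.norm_le_norm_of_nonneg_of_le (star_mul_self_nonneg x)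
    (star_mul_self_le_one_add_conj ha x)
  rw [CStarRing.norm_star_mul_self, CStarRing.norm_star_mul_self] at this
  exact le_of_sq_le_sq (by simpa only [sq] using this) (norm_nonneg _)

/-- For x = (1 + a)⁻¹ this bounds (1 + a)⁻¹ a (1 + a)⁻¹ by 1. -/
theorem norm_conj_le_norm_one_add_mul_sq {a : C} (ha : 0 ≤ a) (x : C) :
    ‖star x * a * x‖ ≤ ‖(1 + a) * x‖ ^ 2 := by
  have := CStarAlgebra.norm_le_norm_of_nonneg_of_le (star_left_conjugate_nonneg ha x)
    (conj_le_one_add_conj ha x)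
  rwa [CStarRing.norm_star_mul_self, ← sq] at this

end CStarAlgebra

namespace ContCStarSeminorm

variable {A : Type*} [NonUnitalRing A] [StarRing A] [Module ℂ A]
    [IsScalarTower ℂ A A] [SMulCommClass ℂ A A] [StarModule ℂ A] [TopologicalSpace A]
    (p : ContCStarSeminorm A)

/-- Holds because 0 ≤ N - b* b ≤ N in the C*-algebra of p. It is the contraction estimate for the
iteration in `exists_quasiInverse`. -/
theorem smul_sub_star_mul_self_mul_le (b x : A) {N : ℝ} (hN : p.toSeminorm (star b * b) ≤ N) :
    p.toSeminorm ((N : ℂ) • x - star b * b * x) ≤ N * p.toSeminorm x := by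
  obtain ⟨C, _, _, _, π, hπ⟩ := exists_ordered_cstarAlgebra p
  rw [← hπ] at hN
  rw [← hπ, ← hπ]
  have h0 : 0 ≤ π (star b * b) := by rw [map_mul, map_star]; exact star_mul_self_nonneg _
  have : π ((N : ℂ) • x - star b * b * x) = (algebraMap ℝ C N - π (star b * b)) * π x := by
    rw [map_sub, map_smul, map_mul π (star b * b), sub_mul, Algebra.algebraMap_eq_smul_one,
      smul_mul_assoc, one_mul]
    rfl
  rw [this]
  exact (norm_mul_le _ _).trans
    (mul_le_mul_of_nonneg_right (norm_algebraMap_sub_le h0 hN) (norm_nonneg _))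

theorem le_add_star_mul_self_mul (b x : A) :
    p.toSeminorm x ≤ p.toSeminorm (x + star b * b * x) := by
  obtain ⟨C, _, _, _, π, hπ⟩ := exists_ordered_cstarAlgebra p
  rw [← hπ, ← hπ]
  have h0 : 0 ≤ π (star b * b) := by rw [map_mul, map_star]; exact star_mul_self_nonneg _
  have := norm_le_norm_one_add_mul h0 (π x)
  rwa [add_mul, one_mul, ← map_mul, ← map_add] at this

/-- If `1 - u` is inverse to `1 + b* b`, then `p(u) ≤ 2`. -/
theorem quasiInverse_le {b u : A} (hu : u + star b * b * u = star b * b) :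
    p.toSeminorm u ≤ 2 := by
  obtain ⟨C, _, _, _, π, hπ⟩ := exists_ordered_cstarAlgebra p
  rw [← hπ]
  have h0 : 0 ≤ π (star b * b) := by rw [map_mul, map_star]; exact star_mul_self_nonneg _
  have hu' : π u + π (star b * b) * π u = π (star b * b) := by rw [← map_mul, ← map_add, hu]
  have h1 : (1 + π (star b * b)) * (1 - π u) = 1 := by
    rw [← sub_eq_zero] at hu' ⊢
    rw [← neg_eq_zero, ← hu']
    noncomm_ring
  have h2 := norm_le_norm_one_add_mul h0 (1 - π u)
  rw [h1] at h2
  have h3 : π u = 1 - (1 - π u) := by abel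
  rw [h3]
  refine (norm_sub_le _ _).trans ?_
  linarith [norm_one_le_one C]

/-- The element is (1 - u)* b* b (1 - u) expanded without a unit, where 1 - u is inverse to 1 + b*
b. For b* b = ⟨ξ,ξ⟩ it is the square ⟨ζ,ζ⟩ of ζ = ξ - ξu. -/
theorem conj_quasiInverse_le {b u : A} (hu : u + star b * b * u = star b * b) :
    p.toSeminorm (star b * b - star b * b * u - star u * (star b * b) +
      star u * (star b * b) * u) ≤ 1 := by
  obtain ⟨C, _, _, _, π, hπ⟩ := exists_ordered_cstarAlgebra p
  rw [← hπ]
  have h0 : 0 ≤ π (star b * b) := by rw [map_mul, map_star]; exact star_mul_self_nonneg _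
  have hu' : π u + π (star b * b) * π u = π (star b * b) := by rw [← map_mul, ← map_add, hu]
  have h1 : (1 + π (star b * b)) * (1 - π u) = 1 := by
    rw [← sub_eq_zero] at hu' ⊢
    rw [← neg_eq_zero, ← hu']
    noncomm_ring
  have h2 := norm_conj_le_norm_one_add_mul_sq h0 (1 - π u)
  rw [h1] at h2
  have h3 : π (star b * b - star b * b * u - star u * (star b * b) +
      star u * (star b * b) * u) = star (1 - π u) * π (star b * b) * (1 - π u) := by
    simp only [map_add, map_sub, map_mul, map_star, star_sub, star_one]
    noncomm_ring
  rw [h3]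
  exact h2.trans (pow_le_one₀ (norm_nonneg _) (norm_one_le_one C))

end ContCStarSeminorm

/-! ### The Cauchy-Schwarz inequality. -/

section CauchySchwarz

variable {A E : Type*} [NonUnitalRing A] [StarRing A] [Module ℂ A]
    [IsScalarTower ℂ A A] [SMulCommClass ℂ A A] [StarModule ℂ A] [TopologicalSpace A]
    [AddCommGroup E] [Module ℂ E] [InnerModule A E]

/-- The Cauchy-Schwarz inequality. -/
theorem ContCStarSeminorm.ip_sq_le (hpos : ∀ ξ : E, ∃ b : A, ip ξ ξ = star b * b)
    (p : ContCStarSeminorm A) (ξ η : E) :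
    p.toSeminorm (ip ξ η : A) ^ 2 ≤
      p.toSeminorm (ip ξ ξ : A) * p.toSeminorm (ip η η : A) := by
  obtain ⟨C, _, _, _, π, hπ⟩ := exists_ordered_cstarAlgebra p
  have hpos' : ∀ ξ : E, 0 ≤ π (ip ξ ξ) := fun ξ => by
    obtain ⟨b, hb⟩ := hpos ξ
    rw [hb, map_mul, map_star]; exact star_mul_self_nonneg _
  simp only [← hπ]
  set x : A := ip ξ η with hx
  -- Expand ⟨ξx - tη, ξx - tη⟩ ≥ 0 and use ⟨ξ,ξ⟩ ≤ t. The strict inequality makes t positive, so it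
  -- can be cancelled; t then decreases to ‖π⟨ξ,ξ⟩‖.
  have key : ∀ t : ℝ, ‖π (ip ξ ξ)‖ < t → ‖π x‖ ^ 2 ≤ t * ‖π (ip η η)‖ := fun t ht => by
    have h0 : 0 < t := (norm_nonneg _).trans_lt ht
    have h1 := hpos' (act ξ x + -((t : ℂ) • η))
    have h2 : (ip (act ξ x + -((t : ℂ) • η)) (act ξ x + -((t : ℂ) • η)) : A) =
        star x * ip ξ ξ * x - (t : ℂ) • (star x * x) - (t : ℂ) • (star x * x)
          + (t : ℂ) • (t : ℂ) • ip η η := by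
      have h3 : (ip η ξ : A) = star x := (star_ip _ _).symm
      simp only [ip_add, add_ip, ip_neg, neg_ip, ip_smul, smul_ip, ip_act, act_ip, h3, ← hx]
      simp only [RCLike.star_def, Complex.conj_ofReal, smul_mul_assoc, mul_assoc, add_mul, neg_mul,
        smul_add, smul_neg]
      abel
    have h4 : π (star x * ip ξ ξ * x) ≤ (t : ℂ) • π (star x * x) := by
      have h5 := star_left_conjugate_le_conjugate
        ((CStarAlgebra.norm_le_iff_le_algebraMap _ h0.le (hpos' ξ)).1 ht.le) (π x)
      rw [Algebra.algebraMap_eq_smul_one, mul_smul_comm, mul_one, smul_mul_assoc, ← map_star,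
        ← map_mul, ← map_mul, ← map_mul] at h5
      exact h5
    rw [h2, map_add, map_sub, map_sub, map_smul, map_smul, map_smul] at h1
    have h6 : (t : ℂ) • π (star x * x) ≤ (t : ℂ) • (t : ℂ) • π (ip η η) := by
      rw [← sub_nonneg]
      refine h1.trans ?_
      rw [← sub_nonneg] at h4 ⊢
      convert h4 using 1
      abel
    have h7 := CStarAlgebra.norm_le_norm_of_nonneg_of_le (a := (t : ℂ) • π (star x * x)) ?_ h6
    · rw [norm_smul, norm_smul, norm_smul, Complex.norm_real, Real.norm_of_nonneg h0.le,
        map_mul, map_star, CStarRing.norm_star_mul_self, ← sq] at h7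
      exact le_of_mul_le_mul_left h7 h0
    · refine smul_nonneg (α := ℝ) h0.le ?_
      rw [map_mul, map_star]; exact star_mul_self_nonneg _
  rcases (norm_nonneg (π (ip η η))).eq_or_lt with h | h
  · have := key _ (lt_add_one _)
    rwa [← h, mul_zero] at this ⊢
  · rw [← div_le_iff₀ h]
    exact le_of_forall_gt_imp_ge_of_dense fun t ht => (div_le_iff₀ h).2 (key t ht)

end CauchySchwarz

theorem InnerModule.star_ip_self {A E : Type*} [NonUnitalRing A] [StarRing A] [Module ℂ A]
    [AddCommGroup E] [Module ℂ E] [InnerModule A E] (ξ : E) :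
    star (ip ξ ξ : A) = ip ξ ξ := star_ip ξ ξ

theorem InnerModule.ip_sub {A E : Type*} [NonUnitalRing A] [StarRing A] [Module ℂ A]
    [AddCommGroup E] [Module ℂ E] [InnerModule A E] (ξ η ζ : E) :
    (ip ξ (η - ζ) : A) = ip ξ η - ip ξ ζ := by
  rw [sub_eq_add_neg, ip_add, ip_neg, ← sub_eq_add_neg]

theorem InnerModule.sub_ip {A E : Type*} [NonUnitalRing A] [StarRing A] [Module ℂ A]
    [AddCommGroup E] [Module ℂ E] [InnerModule A E] (ξ η ζ : E) :
    (ip (ξ - η) ζ : A) = ip ξ ζ - ip η ζ := by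
  rw [sub_eq_add_neg, add_ip, neg_ip, ← sub_eq_add_neg]

theorem InnerModule.sub_act {A E : Type*} [NonUnitalRing A] [StarRing A] [Module ℂ A]
    [AddCommGroup E] [Module ℂ E] [InnerModule A E] (ξ η : E) (a : A) :
    act (ξ - η) a = act ξ a - act η a := by
  rw [sub_eq_add_neg, add_act, neg_act, ← sub_eq_add_neg]

theorem InnerModule.act_neg {A E : Type*} [NonUnitalRing A] [StarRing A] [Module ℂ A]
    [AddCommGroup E] [Module ℂ E] [InnerModule A E] (ξ : E) (a : A) :
    act ξ (-a) = -act ξ a := by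
  have := act_smul (-1 : ℂ) ξ a
  simpa using this

theorem InnerModule.act_sub {A E : Type*} [NonUnitalRing A] [StarRing A] [Module ℂ A]
    [AddCommGroup E] [Module ℂ E] [InnerModule A E] (ξ : E) (a b : A) :
    act ξ (a - b) = act ξ a - act ξ b := by
  rw [sub_eq_add_neg, act_add, act_neg, ← sub_eq_add_neg]

/-! ### Quasi-inverses in a locally C*-algebra, and the algebra as a Hilbert module. -/

namespace LocallyCStarAlgebra

/-- With a = b* b, evaluating u*(1 + a)u in two ways gives u* a = a u; hence u* = a - u* a = a - a u
= u. -/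
theorem isSelfAdjoint_quasiInverse {A : Type*} [NonUnitalRing A] [StarRing A] {b u : A}
    (hu : u + star b * b * u = star b * b) :
    star u = u := by
  have hs : star u + star u * (star b * b) = star b * b := by
    have := congrArg star hu
    simpa only [star_add, star_mul, star_star] using this
  have h1 : star u * (star b * b) = star b * b * u := by
    have h2 : (star u + star u * (star b * b)) * u = star u * (u + star b * b * u) := by
      rw [add_mul, mul_add, mul_assoc]
    rw [hs, hu] at h2
    exact h2.symm
  rw [h1] at hs
  exact add_right_cancel (hs.trans hu.symm)

theorem quasiInverse_comm {A : Type*} [NonUnitalRing A] [StarRing A] {b u : A}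
    (hu : u + star b * b * u = star b * b) :
    u + u * (star b * b) = star b * b := by
  have hs := congrArg star hu
  simpa only [star_add, star_mul, star_star, isSelfAdjoint_quasiInverse hu] using hs

variable {A : Type*} [NonUnitalRing A] [StarRing A] [Module ℂ A]
    [IsScalarTower ℂ A A] [SMulCommClass ℂ A A] [StarModule ℂ A] [UniformSpace A]
    [LocallyCStarAlgebra A]

theorem eq_zero_of_seminorm {a : A} (h : ∀ p : ContCStarSeminorm A, p.toSeminorm a = 0) :
    a = 0 := by
  have : pure a ≤ 𝓝 (0 : A) := (le_nhds_zero_iff _).2 fun p => by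
    rw [tendsto_pure_left]
    intro s hs
    rw [h p]
    exact mem_of_mem_nhds hs
  exact (pure_le_nhds_iff.1 this)

/-- A single seminorm suffices for each neighbourhood because S(A) is closed under maxima. -/
theorem hasBasis_nhds_zero : (𝓝 (0 : A)).HasBasis
    (fun q : ContCStarSeminorm A × ℝ => 0 < q.2) fun q => {a | q.1.toSeminorm a < q.2} := by
  have hdir : DirectedOn (fun q r : ContCStarSeminorm A × ℝ =>
      {a | q.1.toSeminorm a < q.2} ≥ {a | r.1.toSeminorm a < r.2}) {q | 0 < q.2} := by
    rintro ⟨p, ε⟩ hε ⟨q, δ⟩ hδ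
    refine ⟨⟨max p q, min ε δ⟩, show 0 < min ε δ from lt_min hε hδ, fun a ha => ?_, fun a ha => ?_⟩
    · exact (ContCStarSeminorm.le_max_left p q a).trans_lt (lt_of_lt_of_le ha (min_le_left _ _))
    · exact (ContCStarSeminorm.le_max_right p q a).trans_lt (lt_of_lt_of_le ha (min_le_right _ _))
  have hne : {q : ContCStarSeminorm A × ℝ | 0 < q.2}.Nonempty :=
    ⟨⟨default, 1⟩, zero_lt_one (α := ℝ)⟩
  have key : 𝓝 (0 : A) = ⨅ q ∈ {q : ContCStarSeminorm A × ℝ | 0 < q.2},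
      𝓟 {a | q.1.toSeminorm a < q.2} := by
    apply le_antisymm
    · refine le_iInf₂ fun q hq => le_principal_iff.2 ?_
      exact (isOpen_lt q.1.continuous continuous_const).mem_nhds (by simpa using hq)
    · refine (le_nhds_zero_iff _).2 fun p => ?_
      rw [Metric.tendsto_nhds]
      intro ε hε
      refine mem_of_superset (mem_iInf_of_mem (p, ε) (mem_iInf_of_mem hε (mem_principal_self _))) ?_
      intro a ha
      simpa [abs_of_nonneg (apply_nonneg p.toSeminorm a)] using ha
  rw [key]
  exact hasBasis_biInf_principal hdir hne

/-- For each `b`, the element `1 + b* b` is invertible in the unitization. -/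
theorem exists_quasiInverse (b : A) : ∃ u : A, u + star b * b * u = star b * b := by
  set a := star b * b with ha
  set g : A → A := fun u => u + a * u - a with hg
  have happrox : ∀ (p : ContCStarSeminorm A) (n : ℕ), ∃ u, p.toSeminorm (g u) ≤
      (p.toSeminorm a / (1 + p.toSeminorm a)) ^ n * p.toSeminorm a := fun p n => by
    have hN := apply_nonneg p.toSeminorm a
    set N := p.toSeminorm a with hNdef
    induction n with
    | zero => exact ⟨0, by simp [hg, hNdef, map_neg_eq_map]⟩
    | succ n ih =>
      obtain ⟨u, hu⟩ := ih
      -- This step multiplies the residual g(u) by (1 + N)⁻¹(N - a), which contracts by the factor N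
      -- / (1 + N) for p.
      refine ⟨u - ((1 + N : ℝ) : ℂ)⁻¹ • g u, ?_⟩
      have h1 : ((1 + N : ℝ) : ℂ) ≠ 0 := by exact_mod_cast (by positivity : (1 + N) ≠ 0)
      have : g (u - ((1 + N : ℝ) : ℂ)⁻¹ • g u) =
          ((1 + N : ℝ) : ℂ)⁻¹ • ((N : ℂ) • g u - a * g u) := by
        have h2 : g (u - ((1 + N : ℝ) : ℂ)⁻¹ • g u) =
          g u - ((1 + N : ℝ) : ℂ)⁻¹ • g u - ((1 + N : ℝ) : ℂ)⁻¹ • (a * g u) := by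
          simp only [hg, mul_sub, mul_smul_comm]; abel
        have h3 : ((1 + N : ℝ) : ℂ)⁻¹ • ((N : ℂ) • g u) = g u - ((1 + N : ℝ) : ℂ)⁻¹ • g u := by
          have h4 : ((1 + N : ℝ) : ℂ)⁻¹ * (N : ℂ) = 1 - ((1 + N : ℝ) : ℂ)⁻¹ := by
            field_simp
            push_cast
            ring
          rw [smul_smul, h4, sub_smul, one_smul]
        rw [h2, smul_sub _ _ (a * g u), h3]
      rw [this, map_smul_eq_mul, norm_inv, Complex.norm_real, Real.norm_of_nonneg (by positivity)]
      have h5 := p.smul_sub_star_mul_self_mul_le b (g u) le_rfl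
      rw [← ha, ← hNdef] at h5
      calc (1 + N)⁻¹ * _ ≤ (1 + N)⁻¹ * (N * ((N / (1 + N)) ^ n * N)) := by
            gcongr; exact h5.trans (by gcongr)
        _ = _ := by rw [pow_succ]; field_simp
  have hsmall : ∀ (p : ContCStarSeminorm A) (ε : ℝ), 0 < ε → ∃ u, p.toSeminorm (g u) < ε := by
    intro p ε hε
    have hN := apply_nonneg p.toSeminorm a
    have hlt : p.toSeminorm a / (1 + p.toSeminorm a) < 1 := by
      rw [div_lt_one (by positivity)]; linarith
    have ht := (tendsto_pow_atTop_nhds_zero_of_lt_one (by positivity) hlt).mul_const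
      (p.toSeminorm a)
    rw [zero_mul] at ht
    obtain ⟨n, hn⟩ := (ht.eventually (gt_mem_nhds hε)).exists
    obtain ⟨u, hu⟩ := happrox p n
    exact ⟨u, hu.trans_lt hn⟩
  -- The approximate solutions depend on p, so they form a filter and not a sequence.
  have hne : (comap g (𝓝 0)).NeBot := by
    refine comap_neBot_iff.2 fun t ht => ?_
    obtain ⟨q, hq, hqt⟩ := hasBasis_nhds_zero.mem_iff.1 ht
    obtain ⟨u, hu⟩ := hsmall q.1 q.2 hq
    exact ⟨u, hqt hu⟩
  -- By `le_add_star_mul_self_mul`, p(u - v) ≤ p(g(u) - g(v)), so small residuals force approximate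
  -- solutions to be close.
  have hcauchy : Cauchy (comap g (𝓝 0)) := by
    refine ⟨hne, ?_⟩
    rw [uniformity_eq_comap_nhds_zero A, ← tendsto_iff_comap]
    refine (le_nhds_zero_iff _).2 fun p => ?_
    have h1 : Tendsto (fun u => p.toSeminorm (g u)) (comap g (𝓝 0)) (𝓝 0) := by
      have := (p.continuous.tendsto 0).comp (tendsto_comap (f := g) (x := 𝓝 0))
      rwa [map_zero] at this
    have h2 := (h1.comp tendsto_snd).add (h1.comp tendsto_fst)
    rw [add_zero] at h2
    rw [tendsto_map'_iff]
    refine squeeze_zero (fun _ => apply_nonneg _ _) (fun x => ?_) h2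
    refine (p.le_add_star_mul_self_mul b _).trans ?_
    have : x.2 - x.1 + star b * b * (x.2 - x.1) = g x.2 - g x.1 := by
      simp only [hg, mul_sub, ← ha]; abel
    simp only [Function.comp]
    rw [this]
    exact map_sub_le_add _ _ _
  obtain ⟨u, hu⟩ := CompleteSpace.complete hcauchy
  have hgc : Continuous g := (continuous_id.add (continuous_const.mul continuous_id)).sub
    continuous_const
  have h1 : Tendsto g (comap g (𝓝 0)) (𝓝 (g u)) := (hgc.tendsto u).mono_left hu
  have h2 := tendsto_nhds_unique h1 tendsto_comap
  exact ⟨u, sub_eq_zero.1 h2⟩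

instance isHilbertModule_self : IsHilbertModule A A where
  ip_self_nonneg a := ⟨a, rfl⟩
  ip_self_eq_zero a := by
    constructor
    · intro h
      refine eq_zero_of_seminorm fun p => ?_
      have h1 : p.toSeminorm (star a * a) = 0 := by
        change star a * a = 0 at h
        rw [h, map_zero]
      rw [p.star_mul_self] at h1
      exact pow_eq_zero_iff two_ne_zero |>.1 h1
    · rintro rfl
      exact ip_zero _
  complete f hf h := by
    have hc : Cauchy f := by
      refine ⟨hf, ?_⟩
      rw [uniformity_eq_comap_nhds_zero A, ← tendsto_iff_comap]
      refine (le_nhds_zero_iff _).2 fun p => ?_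
      rw [tendsto_map'_iff, Metric.tendsto_nhds]
      intro ε hε
      obtain ⟨s, hs, hlt⟩ := h _ ⟨p, rfl⟩ ε hε
      refine mem_of_superset (prod_mem_prod hs hs) fun x hx => ?_
      have := hlt x.2 hx.2 x.1 hx.1
      rw [p.modSeminorm_self] at this
      simpa [abs_of_nonneg (apply_nonneg p.toSeminorm _)] using this
    obtain ⟨u, hu⟩ := CompleteSpace.complete hc
    refine ⟨u, ?_⟩
    rintro _ ⟨p, rfl⟩ ε hε
    have hpc : Continuous fun a => p.toSeminorm (a - u) :=
      p.continuous.comp (continuous_id.sub continuous_const)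
    have ht := (hpc.tendsto u).mono_left hu
    rw [sub_self, map_zero] at ht
    filter_upwards [ht.eventually (gt_mem_nhds hε)] with a ha
    rwa [p.modSeminorm_self]

end LocallyCStarAlgebra

/-! ### Seminorms and approximate units in Hilbert modules. -/

section HilbertModule

variable {A E : Type*} [NonUnitalRing A] [StarRing A] [Module ℂ A]
    [IsScalarTower ℂ A A] [SMulCommClass ℂ A A] [StarModule ℂ A] [UniformSpace A]
    [AddCommGroup E] [Module ℂ E] [InnerModule A E]

namespace ContCStarSeminorm

section

variable (p : ContCStarSeminorm A) 

theorem modSeminorm_sq (ξ : E) :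
    modSeminorm p.toSeminorm ξ ^ 2 = p.toSeminorm (ip ξ ξ : A) :=
  Real.sq_sqrt (apply_nonneg _ _)

theorem modSeminorm_nonneg (ξ : E) : 0 ≤ modSeminorm p.toSeminorm ξ := Real.sqrt_nonneg _

theorem modSeminorm_act_le (ξ : E) (a : A) :
    modSeminorm p.toSeminorm (act ξ a) ≤ modSeminorm p.toSeminorm ξ * p.toSeminorm a := by
  refine le_of_sq_le_sq ?_ (mul_nonneg (p.modSeminorm_nonneg _) (apply_nonneg _ _))
  rw [modSeminorm_sq, ip_act, act_ip, mul_pow, modSeminorm_sq, sq (p.toSeminorm a)]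
  refine (p.mul_le _ _).trans ?_
  refine (mul_le_mul_of_nonneg_right (p.mul_le _ _) (apply_nonneg _ _)).trans ?_
  rw [p.star_eq]
  apply le_of_eq
  ring

variable [IsHilbertModule A E]

theorem ip_le (ξ η : E) :
    p.toSeminorm (ip ξ η : A) ≤ modSeminorm p.toSeminorm ξ * modSeminorm p.toSeminorm η := by
  refine le_of_sq_le_sq ?_ (mul_nonneg (p.modSeminorm_nonneg _) (p.modSeminorm_nonneg _))
  rw [mul_pow, modSeminorm_sq, modSeminorm_sq]
  exact p.ip_sq_le IsHilbertModule.ip_self_nonneg ξ η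

variable (E) in
/-- The seminorm `p̄` on a Hilbert module. -/
noncomputable def moduleSeminorm : Seminorm ℂ E :=
  Seminorm.of (modSeminorm p.toSeminorm)
    (fun ξ η => by
      refine le_of_sq_le_sq ?_ (add_nonneg (p.modSeminorm_nonneg _) (p.modSeminorm_nonneg _))
      rw [modSeminorm_sq, ip_add, add_ip, add_ip, add_sq, modSeminorm_sq, modSeminorm_sq]
      have h1 := p.ip_le ξ η
      have h2 := p.ip_le η ξ
      have h3 := map_add_le_add p.toSeminorm (ip ξ ξ + ip η ξ) (ip ξ η + ip η η : A)
      have h4 := map_add_le_add p.toSeminorm (ip ξ ξ) (ip η ξ : A)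
      have h5 := map_add_le_add p.toSeminorm (ip ξ η) (ip η η : A)
      linarith)
    (fun c ξ => by
      rw [modSeminorm, ip_smul, smul_ip, map_smul_eq_mul, map_smul_eq_mul, norm_star, ← mul_assoc,
        Real.sqrt_mul (by positivity), Real.sqrt_mul_self (norm_nonneg c)]
      rfl)

theorem moduleSeminorm_sq (ξ : E) : p.moduleSeminorm E ξ ^ 2 = p.toSeminorm (ip ξ ξ : A) :=
  p.modSeminorm_sq ξ

theorem moduleSeminorm_act_le (ξ : E) (a : A) :
    p.moduleSeminorm E (act ξ a) ≤ p.moduleSeminorm E ξ * p.toSeminorm a :=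
  p.modSeminorm_act_le ξ a

theorem norm_ip_le (ξ η : E) :
    p.toSeminorm (ip ξ η : A) ≤ p.moduleSeminorm E ξ * p.moduleSeminorm E η := p.ip_le ξ η

theorem moduleSeminorm_self [LocallyCStarAlgebra A] (a : A) :
    p.moduleSeminorm A a = p.toSeminorm a := p.modSeminorm_self a

end

end ContCStarSeminorm

namespace IsHilbertModule

variable [LocallyCStarAlgebra A] [IsHilbertModule A E]

variable (A) in
theorem eq_zero_of_seminorm {ξ : E} (h : ∀ p : ContCStarSeminorm A, p.moduleSeminorm E ξ = 0) :
    ξ = 0 := by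
  refine (ip_self_eq_zero (A := A) ξ).1 (LocallyCStarAlgebra.eq_zero_of_seminorm fun p => ?_)
  rw [← p.moduleSeminorm_sq, h p, sq, zero_mul]

variable (A) in
-- Taking a = ⟨ξ,ξ⟩ gives ⟨ξ,ξ⟩* ⟨ξ,ξ⟩ = ⟨ξ, ξa⟩ = 0.
theorem eq_zero_of_act {ξ : E} (h : ∀ a : A, act ξ a = 0) : ξ = 0 := by
  refine (ip_self_eq_zero (A := A) ξ).1 ?_
  refine (ip_self_eq_zero (A := A) (ip ξ ξ : A)).1 ?_
  change star (ip ξ ξ : A) * ip ξ ξ = 0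
  rw [star_ip_self, ← ip_act, h, ip_zero]

variable (A) in
theorem eq_of_act {ξ η : E} (h : ∀ a : A, act ξ a = act η a) : ξ = η := by
  rw [← sub_eq_zero]
  refine eq_zero_of_act A fun a => ?_
  rw [sub_act, h, sub_self]

variable (A) in
/-- Each `ξ` is the sum of an element on which all seminorms are at most `1` and of its
multiple by `⟨ξ, ξ⟩`; here `u = ⟨ξ, ξ⟩ (1 + ⟨ξ, ξ⟩)⁻¹`. -/
theorem exists_bounded_part (ξ : E) : ∃ u : A,
    (∀ p : ContCStarSeminorm A, p.toSeminorm u ≤ 2) ∧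
    (∀ p : ContCStarSeminorm A, p.moduleSeminorm E (ξ - act ξ u) ≤ 1) ∧
    ξ = (ξ - act ξ u) + act (ξ - act ξ u) (ip ξ ξ : A) := by
  obtain ⟨b, hb⟩ := ip_self_nonneg (A := A) ξ
  obtain ⟨u, hu⟩ := LocallyCStarAlgebra.exists_quasiInverse b
  refine ⟨u, fun p => p.quasiInverse_le hu, fun p => ?_, ?_⟩
  · refine le_of_sq_le_sq ?_ zero_le_one
    rw [p.moduleSeminorm_sq, one_pow]
    refine le_trans (le_of_eq ?_) (p.conj_quasiInverse_le hu)
    congr 1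
    rw [ip_sub, sub_ip, sub_ip, ip_act, ip_act, act_ip, hb]
    abel
  -- The other one-sided form, (1 - u)(1 + ⟨ξ,ξ⟩) = 1, applied to ξ.
  · have h := LocallyCStarAlgebra.quasiInverse_comm hu
    rw [← hb] at h
    rw [sub_act, ← act_mul]
    have h1 := congrArg (act ξ) h
    rw [act_add] at h1
    rw [← h1]
    abel

variable (A) in
/-- An approximate unit for `ξ`, uniformly in all seminorms. -/
theorem exists_approx_unit (ξ : E) {ε : ℝ} (hε : 0 < ε) : ∃ u : A,
    (∀ p : ContCStarSeminorm A, p.toSeminorm u ≤ 2) ∧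
    (∀ p : ContCStarSeminorm A, p.moduleSeminorm E (ξ - act ξ u) ≤ ε) := by
  -- The bound 1 for ε⁻¹ξ becomes ε for ξ, while the bound 2 on u does not depend on the scaling.
  obtain ⟨u, hu, hu', -⟩ := exists_bounded_part A (((ε⁻¹ : ℝ) : ℂ) • ξ)
  refine ⟨u, hu, fun p => ?_⟩
  have := hu' p
  rw [smul_act, ← smul_sub, map_smul_eq_mul, Complex.norm_real,
    Real.norm_of_nonneg (inv_pos.2 hε).le] at this
  rwa [inv_mul_le_iff₀ hε, mul_one] at this

end IsHilbertModule

end HilbertModule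

/-! ### The Banach space of uniformly bounded vectors. -/

section BoundedPart

variable (A E : Type*) [NonUnitalRing A] [StarRing A] [Module ℂ A]
    [IsScalarTower ℂ A A] [SMulCommClass ℂ A A] [StarModule ℂ A] [UniformSpace A]
    [LocallyCStarAlgebra A] [AddCommGroup E] [Module ℂ E] [InnerModule A E] [IsHilbertModule A E]

/-- The vectors on which the seminorms of a Hilbert module are uniformly bounded. -/
def boundedPart : Submodule ℂ E where
  carrier := {ξ | ∃ c, ∀ p : ContCStarSeminorm A, p.moduleSeminorm E ξ ≤ c}
  add_mem' := by
    rintro ξ η ⟨c, hc⟩ ⟨d, hd⟩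
    exact ⟨c + d, fun p => (map_add_le_add _ _ _).trans (add_le_add (hc p) (hd p))⟩
  zero_mem' := ⟨0, fun p => (map_zero _).le⟩
  smul_mem' := by
    rintro z ξ ⟨c, hc⟩
    refine ⟨‖z‖ * c, fun p => ?_⟩
    rw [map_smul_eq_mul]
    exact mul_le_mul_of_nonneg_left (hc p) (norm_nonneg z)

namespace boundedPart

variable {A E}

theorem bddAbove (ξ : boundedPart A E) :
    BddAbove (Set.range fun p : ContCStarSeminorm A => p.moduleSeminorm E ξ) := by
  obtain ⟨c, hc⟩ := ξ.2
  exact ⟨c, by rintro _ ⟨p, rfl⟩; exact hc p⟩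

noncomputable instance : NormedAddCommGroup (boundedPart A E) :=
  AddGroupNorm.toNormedAddCommGroup
    { toFun := fun ξ => ⨆ p : ContCStarSeminorm A, p.moduleSeminorm E ξ
      map_zero' := by simp
      add_le' := fun ξ η => ciSup_le fun p => (map_add_le_add _ _ _).trans
        (add_le_add (le_ciSup (bddAbove ξ) p) (le_ciSup (bddAbove η) p))
      neg' := fun ξ => by simp [map_neg_eq_map]
      eq_zero_of_map_eq_zero' := fun ξ h => Subtype.ext <|
        IsHilbertModule.eq_zero_of_seminorm A fun p => le_antisymm
          ((le_ciSup (bddAbove ξ) p).trans h.le) (apply_nonneg _ _) }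

theorem le_norm (p : ContCStarSeminorm A) (ξ : boundedPart A E) :
    p.moduleSeminorm E ξ ≤ ‖ξ‖ := le_ciSup (bddAbove ξ) p

theorem norm_le {ξ : boundedPart A E} {c : ℝ}
    (h : ∀ p : ContCStarSeminorm A, p.moduleSeminorm E ξ ≤ c) : ‖ξ‖ ≤ c := ciSup_le h

noncomputable instance : NormedSpace ℂ (boundedPart A E) where
  norm_smul_le z ξ := norm_le fun p => by
    rw [Submodule.coe_smul, map_smul_eq_mul]
    exact mul_le_mul_of_nonneg_left (le_norm p ξ) (norm_nonneg z)

/-- A Cauchy sequence for the supremum norm converges in E for each seminorm; its Cauchy bounds are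
uniform in p and survive the limit, so the limit is bounded and attained in norm. -/
instance : CompleteSpace (boundedPart A E) := by
  refine Metric.complete_of_cauchySeq_tendsto fun u hu => ?_
  rw [Metric.cauchySeq_iff] at hu
  obtain ⟨ζ, hζ⟩ := IsHilbertModule.complete (A := A) (map (fun n => (u n : E)) atTop)
    inferInstance (by
      rintro _ ⟨p, rfl⟩ ε hε
      obtain ⟨N, hN⟩ := hu ε hε
      refine ⟨_, image_mem_map (Ici_mem_atTop N), ?_⟩
      rintro _ ⟨m, hm, rfl⟩ _ ⟨n, hn, rfl⟩
      refine (le_norm p (u m - u n)).trans_lt ?_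
      rw [← dist_eq_norm]
      exact hN m hm n hn)
  have key : ∀ ε > 0, ∃ N, ∀ n ≥ N, ∀ p : ContCStarSeminorm A,
      p.moduleSeminorm E (u n - ζ) ≤ ε := fun ε hε => by
    obtain ⟨N, hN⟩ := hu ε hε
    refine ⟨N, fun n hn p => le_of_forall_pos_le_add fun δ hδ => ?_⟩
    have h1 := hζ _ ⟨p, rfl⟩ δ hδ
    rw [eventually_map] at h1
    obtain ⟨m, hm, hmN⟩ := (h1.and (eventually_ge_atTop N)).exists
    have h2 : (u n - ζ : E) = (u n - u m : boundedPart A E) + (u m - ζ) := by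
      rw [Submodule.coe_sub]; abel
    rw [h2]
    refine (map_add_le_add _ _ _).trans (add_le_add ?_ hm.le)
    refine (le_norm p _).trans ?_
    rw [← dist_eq_norm]
    exact (hN n hn m hmN).le
  have hmem : ζ ∈ boundedPart A E := by
    obtain ⟨N, hN⟩ := key 1 one_pos
    have : ζ = u N - (u N - ζ) := by abel
    rw [this]
    exact Submodule.sub_mem _ (u N).2 ⟨1, hN N le_rfl⟩
  refine ⟨⟨ζ, hmem⟩, Metric.tendsto_atTop.2 fun ε hε => ?_⟩
  obtain ⟨N, hN⟩ := key (ε / 2) (half_pos hε)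
  refine ⟨N, fun n hn => ?_⟩
  rw [dist_eq_norm]
  exact (norm_le (hN n hn)).trans_lt (half_lt_self hε)

end boundedPart

end BoundedPart

/-! ### Boundedness of adjointable operators and their operator seminorms. -/

namespace Adj

variable {A E F G : Type*} [NonUnitalRing A] [StarRing A] [Module ℂ A]
    [IsScalarTower ℂ A A] [SMulCommClass ℂ A A] [StarModule ℂ A] [UniformSpace A]
    [LocallyCStarAlgebra A]
    [AddCommGroup E] [Module ℂ E] [InnerModule A E] [IsHilbertModule A E]
    [AddCommGroup F] [Module ℂ F] [InnerModule A F] [IsHilbertModule A F]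
    [AddCommGroup G] [Module ℂ G] [InnerModule A G] [IsHilbertModule A G]

/-- Uniform boundedness for the maps ξ ↦ ⟨η, Tξ⟩ with p̄(η) ≤ 1, taken into a C*-algebra whose norm
restricts to p. Each is continuous since it equals ⟨T*η, ξ⟩, and at ξ they are all bounded by
p̄(Tξ). Testing with η = Tξ / p̄(Tξ) recovers p̄(Tξ). -/
theorem exists_bound_boundedPart (T : Adj A E F) (p : ContCStarSeminorm A) :
    ∃ c, ∀ ξ : boundedPart A E, p.moduleSeminorm F (T.map ξ) ≤ c * ‖ξ‖ := by
  obtain ⟨B, _, π, hπ⟩ := exists_cstarAlgebra_of_seminorm p.toSeminorm p.mul_le p.star_mul_self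
  let g : {η : F // p.moduleSeminorm F η ≤ 1} → boundedPart A E →L[ℂ] B := fun η =>
    LinearMap.mkContinuous
      { toFun := fun ξ => π (ip (η : F) (T.map ξ))
        map_add' := fun ξ ζ => by rw [Submodule.coe_add, map_add, ip_add, map_add]
        map_smul' := fun z ξ => by
          rw [Submodule.coe_smul, map_smul, ip_smul, map_smul, RingHom.id_apply] }
      (p.moduleSeminorm E (T.adj η)) fun ξ => by
        change ‖π (ip (η : F) (T.map ξ))‖ ≤ _
        rw [hπ, ← star_ip, T.ip_map, star_ip]
        exact (p.norm_ip_le _ _).trans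
          (mul_le_mul_of_nonneg_left (boundedPart.le_norm p ξ) (apply_nonneg _ _))
  obtain ⟨c, hc⟩ := banach_steinhaus (g := g) fun ξ => ⟨p.moduleSeminorm F (T.map ξ), fun η => by
    change ‖π (ip (η : F) (T.map ξ))‖ ≤ _
    rw [hπ]
    exact (p.norm_ip_le _ _).trans (mul_le_of_le_one_left (apply_nonneg _ _) η.2)⟩
  have hc0 : 0 ≤ c := (norm_nonneg _).trans (hc ⟨0, by rw [map_zero]; exact zero_le_one⟩)
  refine ⟨c, fun ξ => ?_⟩
  rcases (apply_nonneg (p.moduleSeminorm F) (T.map ξ)).eq_or_lt with h | h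
  · rw [← h]
    exact mul_nonneg hc0 (norm_nonneg _)
  set r := p.moduleSeminorm F (T.map ξ) with hr
  have hη : p.moduleSeminorm F (((r⁻¹ : ℝ) : ℂ) • T.map ξ) ≤ 1 := by
    rw [map_smul_eq_mul, Complex.norm_real, Real.norm_of_nonneg (inv_pos.2 h).le, ← hr,
      inv_mul_cancel₀ h.ne']
  have h1 : ‖π (ip (((r⁻¹ : ℝ) : ℂ) • T.map ξ) (T.map ξ))‖ ≤ c * ‖ξ‖ :=
    ((g ⟨_, hη⟩).le_opNorm ξ).trans (mul_le_mul_of_nonneg_right (hc _) (norm_nonneg _))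
  rw [hπ, smul_ip, map_smul_eq_mul, norm_star, Complex.norm_real,
    Real.norm_of_nonneg (inv_pos.2 h).le, ← p.moduleSeminorm_sq, ← hr, sq,
    inv_mul_cancel_left₀ h.ne'] at h1
  exact h1

/-- Write ξ = ζ + ζ⟨ξ,ξ⟩ with ζ in the unit ball of `boundedPart`. Then Tζ obeys the previous bound,
and so does T(ζ⟨ξ,ξ⟩) = (Tζ)⟨ξ,ξ⟩, since p⟨ξ,ξ⟩ ≤ 1. -/
theorem exists_bound (T : Adj A E F) (p : ContCStarSeminorm A) :
    ∃ c, ∀ ξ : E, p.moduleSeminorm E ξ ≤ 1 → p.moduleSeminorm F (T.map ξ) ≤ c := by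
  obtain ⟨c, hc⟩ := T.exists_bound_boundedPart p
  refine ⟨|c| + |c|, fun ξ hξ => ?_⟩
  obtain ⟨u, -, hu, hdec⟩ := IsHilbertModule.exists_bounded_part A ξ
  have h1 : p.moduleSeminorm F (T.map (ξ - act ξ u)) ≤ |c| := by
    refine (hc ⟨ξ - act ξ u, 1, hu⟩).trans ?_
    exact (mul_le_mul_of_nonneg_right (le_abs_self c) (norm_nonneg _)).trans
      (mul_le_of_le_one_right (abs_nonneg c) (boundedPart.norm_le hu))
  rw [hdec, map_add, T.map_act]
  refine (map_add_le_add _ _ _).trans (add_le_add h1 ?_)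
  refine (p.moduleSeminorm_act_le _ _).trans ?_
  rw [← p.moduleSeminorm_sq]
  refine (mul_le_of_le_one_right (apply_nonneg _ _) ?_).trans h1
  exact pow_le_one₀ (apply_nonneg _ _) hξ

/-- Since p̄(Tξ)² = p⟨ξ, T*Tξ⟩. It settles `le_opSeminorm` for the vectors that cannot be
normalised. -/
theorem map_eq_zero_of_seminorm (T : Adj A E F) (p : ContCStarSeminorm A) {ξ : E}
    (h : p.moduleSeminorm E ξ = 0) : p.moduleSeminorm F (T.map ξ) = 0 := by
  have h1 := p.moduleSeminorm_sq (T.map ξ)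
  rw [T.ip_map] at h1
  have h2 := p.norm_ip_le ξ (T.adj (T.map ξ))
  rw [h, zero_mul, ← h1] at h2
  exact pow_eq_zero_iff two_ne_zero |>.1 (le_antisymm h2 (sq_nonneg _))

section opSeminorm

variable (p : ContCStarSeminorm A)

theorem bddAbove_opSeminorm (T : Adj A E F) :
    BddAbove {r : ℝ | ∃ ξ : E, modSeminorm p.toSeminorm ξ ≤ 1 ∧
      r = modSeminorm p.toSeminorm (T.map ξ)} := by
  obtain ⟨c, hc⟩ := T.exists_bound p
  exact ⟨c, by rintro _ ⟨ξ, hξ, rfl⟩; exact hc ξ hξ⟩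

theorem le_opSeminorm_of_le_one (T : Adj A E F) {ξ : E} (hξ : p.moduleSeminorm E ξ ≤ 1) :
    p.moduleSeminorm F (T.map ξ) ≤ opSeminorm p.toSeminorm T :=
  le_csSup (T.bddAbove_opSeminorm p) ⟨ξ, hξ, rfl⟩

theorem opSeminorm_le (T : Adj A E F) {c : ℝ}
    (h : ∀ ξ : E, p.moduleSeminorm E ξ ≤ 1 → p.moduleSeminorm F (T.map ξ) ≤ c) :
    opSeminorm p.toSeminorm T ≤ c :=
  csSup_le ⟨_, 0, (map_zero (p.moduleSeminorm E)).trans_le zero_le_one, rfl⟩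
    (by rintro _ ⟨ξ, hξ, rfl⟩; exact h ξ hξ)

theorem opSeminorm_nonneg (T : Adj A E F) : 0 ≤ opSeminorm p.toSeminorm T :=
  (apply_nonneg (p.moduleSeminorm F) _).trans
    (T.le_opSeminorm_of_le_one p ((map_zero (p.moduleSeminorm E)).trans_le zero_le_one))

theorem le_opSeminorm (T : Adj A E F) (ξ : E) :
    p.moduleSeminorm F (T.map ξ) ≤ opSeminorm p.toSeminorm T * p.moduleSeminorm E ξ := by
  rcases (apply_nonneg (p.moduleSeminorm E) ξ).eq_or_lt with h | h
  · rw [← h, mul_zero, T.map_eq_zero_of_seminorm p h.symm]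
  set r := p.moduleSeminorm E ξ with hr
  have h1 := T.le_opSeminorm_of_le_one p (ξ := ((r⁻¹ : ℝ) : ℂ) • ξ) (by
    rw [map_smul_eq_mul, Complex.norm_real, Real.norm_of_nonneg (inv_pos.2 h).le, ← hr,
      inv_mul_cancel₀ h.ne'])
  rwa [map_smul, map_smul_eq_mul, Complex.norm_real, Real.norm_of_nonneg (inv_pos.2 h).le,
    inv_mul_le_iff₀ h, mul_comm] at h1

theorem opSeminorm_zero : opSeminorm p.toSeminorm (0 : Adj A E F) = 0 :=
  le_antisymm (opSeminorm_le p _ fun ξ _ => by rw [zero_map, map_zero]) (opSeminorm_nonneg p _)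

theorem opSeminorm_add_le (S T : Adj A E F) :
    opSeminorm p.toSeminorm (S + T) ≤ opSeminorm p.toSeminorm S + opSeminorm p.toSeminorm T :=
  opSeminorm_le p _ fun ξ hξ => by
    rw [add_map]
    exact (map_add_le_add _ _ _).trans
      (add_le_add (S.le_opSeminorm_of_le_one p hξ) (T.le_opSeminorm_of_le_one p hξ))

theorem opSeminorm_smul_le (c : ℂ) (T : Adj A E F) :
    opSeminorm p.toSeminorm (c • T) ≤ ‖c‖ * opSeminorm p.toSeminorm T :=
  opSeminorm_le p _ fun ξ hξ => by
    rw [smul_map, map_smul_eq_mul]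
    exact mul_le_mul_of_nonneg_left (T.le_opSeminorm_of_le_one p hξ) (norm_nonneg c)

theorem opSeminorm_comp_le (S : Adj A F G) (T : Adj A E F) :
    opSeminorm p.toSeminorm (S.comp T) ≤
      opSeminorm p.toSeminorm S * opSeminorm p.toSeminorm T :=
  opSeminorm_le p _ fun ξ hξ => by
    rw [comp_map]
    exact (S.le_opSeminorm p _).trans
      (mul_le_mul_of_nonneg_left (T.le_opSeminorm_of_le_one p hξ) (opSeminorm_nonneg p S))

theorem opSeminorm_sq_le (T : Adj A E F) :
    opSeminorm p.toSeminorm T ^ 2 ≤ opSeminorm p.toSeminorm (T.adjoint.comp T) := by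
  have h0 := opSeminorm_nonneg p (T.adjoint.comp T)
  refine (Real.le_sqrt (opSeminorm_nonneg p T) h0).1 ?_
  refine opSeminorm_le p T fun ξ hξ => Real.le_sqrt_of_sq_le ?_
  rw [p.moduleSeminorm_sq, T.ip_map]
  refine (p.norm_ip_le _ _).trans ?_
  refine (mul_le_of_le_one_left (apply_nonneg _ _) hξ).trans ?_
  exact (T.adjoint.comp T).le_opSeminorm_of_le_one p hξ

theorem opSeminorm_le_adjoint (T : Adj A E F) :
    opSeminorm p.toSeminorm T ≤ opSeminorm p.toSeminorm T.adjoint := by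
  rcases (opSeminorm_nonneg p T).eq_or_lt with h | h
  · rw [← h]; exact opSeminorm_nonneg p _
  · refine le_of_mul_le_mul_right ?_ h
    rw [← sq]
    exact (opSeminorm_sq_le p T).trans (opSeminorm_comp_le p _ _)

theorem opSeminorm_adjoint (T : Adj A E F) :
    opSeminorm p.toSeminorm T.adjoint = opSeminorm p.toSeminorm T :=
  le_antisymm (opSeminorm_le_adjoint p T.adjoint) (opSeminorm_le_adjoint p T)

/-- The C*-identity; on M(E) it identifies the seminorm of the M(A)-valued inner product with p̃. -/
theorem opSeminorm_adjoint_comp_self (T : Adj A E F) :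
    opSeminorm p.toSeminorm (T.adjoint.comp T) = opSeminorm p.toSeminorm T ^ 2 := by
  refine le_antisymm ((opSeminorm_comp_le p _ _).trans ?_) (opSeminorm_sq_le p T)
  rw [opSeminorm_adjoint, sq]

end opSeminorm

end Adj

/-! ### The embedding of E in M(E) and the action of L_A(E) on M(E). -/

namespace Adj

section Definite

variable {A E F : Type*} [NonUnitalRing A] [StarRing A] [Module ℂ A]
    [AddCommGroup E] [Module ℂ E] [InnerModule A E]
    [AddCommGroup F] [Module ℂ F] [InnerModule A F]

theorem ext_map (hE : ∀ ξ : E, (ip ξ ξ : A) = 0 → ξ = 0) {S T : Adj A E F}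
    (h : ∀ ξ, S.map ξ = T.map ξ) : S = T := by
  refine Adj.ext h fun η => ?_
  rw [← sub_eq_zero]
  refine hE _ ?_
  rw [ip_sub, ← S.ip_map, ← T.ip_map, h, sub_self]

end Definite

section Maps

variable {A E : Type*} [NonUnitalRing A] [StarRing A] [Module ℂ A]
    [IsScalarTower ℂ A A] [SMulCommClass ℂ A A]
    [AddCommGroup E] [Module ℂ E] [InnerModule A E]

variable (A) in
/-- The embedding `E → M(E)`, which maps `ξ` to `a ↦ ξ a`. -/
def ofVector (ξ : E) : MultMod A E where
  map :=
    { toFun := fun a => act ξ a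
      map_add' := fun _ _ => act_add _ _ _
      map_smul' := fun _ _ => act_smul _ _ _ }
  adj :=
    { toFun := fun η => ip ξ η
      map_add' := fun _ _ => ip_add _ _ _
      map_smul' := fun _ _ => ip_smul _ _ _ }
  map_act _ _ := act_mul _ _ _
  adj_act _ _ := ip_act _ _ _
  ip_map _ _ := act_ip _ _ _

@[simp] theorem ofVector_map (ξ : E) (a : A) : (ofVector A ξ).map a = act ξ a := rfl
@[simp] theorem ofVector_adj (ξ η : E) : (ofVector A ξ).adj η = ip ξ η := rfl

theorem ofVector_add (ξ η : E) : ofVector A (ξ + η) = ofVector A ξ + ofVector A η := by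
  ext <;> simp [add_act, add_ip]

theorem ofVector_smul [StarModule ℂ A] (c : ℂ) (ξ : E) :
    ofVector A (c • ξ) = c • ofVector A ξ := by
  ext <;> simp [smul_act, smul_ip]

theorem comp_ofVector {F : Type*} [AddCommGroup F] [Module ℂ F] [InnerModule A F]
    (T : Adj A F E) (ξ : F) : T.comp (ofVector A ξ) = ofVector A (T.map ξ) := by
  ext x
  · exact T.map_act ξ x
  · exact (T.ip_map ξ x).symm

/-- Multiplying by elements of A moves M(E) into E; this reduces M(A)-linear maps on M(E) to their
restriction to E. -/
theorem act_ofVector [StarModule ℂ A] (s : MultMod A E) (a : A) :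
    act s (MultAlg.ofAdj (ofVector A a)) = ofVector A (s.map a) := by
  rw [← comp_ofVector]
  change s.comp (MultAlg.toAdj _) = _
  rw [MultAlg.toAdj_ofAdj]

theorem ofVector_act [StarModule ℂ A] (ξ : E) (a : A) : ofVector A (act ξ a) =
    act (ofVector A ξ) (MultAlg.ofAdj (ofVector A a)) := by
  rw [act_ofVector, ofVector_map]

variable [StarModule ℂ A]

variable (A E) in
/-- An adjointable operator on `E` acts on `M(E)` by composition. -/
def leftComp : Adj A E E →⋆ₙₐ[ℂ] Adj (MultAlg A) (MultMod A E) (MultMod A E) where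
  toFun T :=
    { map :=
        { toFun := fun s => T.comp s
          map_add' := fun _ _ => by ext <;> simp
          map_smul' := fun _ _ => by ext <;> simp }
      adj :=
        { toFun := fun s => T.adjoint.comp s
          map_add' := fun _ _ => by ext <;> simp
          map_smul' := fun _ _ => by ext <;> simp }
      map_act := fun _ _ => rfl
      adj_act := fun _ _ => rfl
      ip_map := fun _ _ => rfl }
  map_smul' c T := by
    refine Adj.ext (fun s => ?_) (fun s => ?_)
    · exact Adj.ext (fun _ => rfl) (fun _ => s.adj.map_smul _ _)
    · refine Adj.ext (fun _ => rfl) (fun x => ?_)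
      change s.adj (c • T.map x) = star (star c) • s.adj (T.map x)
      rw [map_smul, star_star]
  map_zero' := Adj.ext (fun s => Adj.ext (fun _ => rfl) (fun _ => s.adj.map_zero))
    (fun s => Adj.ext (fun _ => rfl) (fun _ => s.adj.map_zero))
  map_add' S T := Adj.ext (fun s => Adj.ext (fun _ => rfl) (fun _ => s.adj.map_add _ _))
    (fun s => Adj.ext (fun _ => rfl) (fun _ => s.adj.map_add _ _))
  map_mul' S T := rfl
  map_star' S := rfl

@[simp] theorem leftComp_map (T : Adj A E E) (s : MultMod A E) :
    (leftComp A E T).map s = T.comp s := rfl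

/-- Associativity: (s t*) x = s (t* x), and t* x is the multiplier ⟨t, x⟩. -/
theorem leftComp_comp_adjoint (s t : MultMod A E) :
    leftComp A E (s.comp t.adjoint) = rankOne (A := MultAlg A) s t := by
  have h : ∀ s t x : MultMod A E, (s.comp t.adjoint).comp x =
      s.comp (MultAlg.toAdj (MultAlg.ofAdj (t.adjoint.comp x))) := fun s t x => by
    rw [MultAlg.toAdj_ofAdj]; rfl
  exact Adj.ext (fun x => h s t x) (fun x => h t s x)

theorem ofVector_comp_adjoint (η ξ : E) :
    (ofVector A η).comp (ofVector A ξ).adjoint = rankOne (A := A) η ξ := rfl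

end Maps

/-! ### Composition as an isometric isomorphism onto L_{M(A)}(M(E)). -/

section LocallyCStar

variable {A E : Type*} [NonUnitalRing A] [StarRing A] [Module ℂ A]
    [IsScalarTower ℂ A A] [SMulCommClass ℂ A A] [StarModule ℂ A] [UniformSpace A]
    [LocallyCStarAlgebra A]
    [AddCommGroup E] [Module ℂ E] [InnerModule A E] [IsHilbertModule A E]

theorem ext_map_of_isHilbertModule {F : Type*} [AddCommGroup F] [Module ℂ F] [InnerModule A F]
    {S T : Adj A E F} (h : ∀ ξ, S.map ξ = T.map ξ) : S = T :=
  ext_map (fun ξ => (IsHilbertModule.ip_self_eq_zero ξ).1) h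

theorem ofVector_injective : Function.Injective (ofVector A : E → MultMod A E) := fun ξ η h =>
  IsHilbertModule.eq_of_act A fun a => by rw [← ofVector_map, h, ofVector_map]

theorem multMod_definite (s : MultMod A E) (h : (ip s s : MultAlg A) = 0) : s = 0 := by
  refine ext_map_of_isHilbertModule fun a => (IsHilbertModule.ip_self_eq_zero (A := A) _).1 ?_
  have h1 : s.adj (s.map a) = 0 := congrArg (fun m : MultAlg A => m.l a) h
  rw [s.ip_map, h1, ip_zero]

section Seminorms

variable (p : ContCStarSeminorm A)

/-- The lower bound tests the adjoint ⟨ξ, ·⟩ on ξ itself. -/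
theorem opSeminorm_ofVector (ξ : E) :
    opSeminorm p.toSeminorm (ofVector A ξ) = p.moduleSeminorm E ξ := by
  apply le_antisymm
  · refine opSeminorm_le p _ fun a ha => ?_
    rw [p.moduleSeminorm_self] at ha
    exact (p.moduleSeminorm_act_le ξ a).trans (mul_le_of_le_one_right (apply_nonneg _ _) ha)
  · rcases (apply_nonneg (p.moduleSeminorm E) ξ).eq_or_lt with h | h
    · rw [← h]; exact opSeminorm_nonneg p _
    · refine le_of_mul_le_mul_right ?_ h
      rw [← sq, p.moduleSeminorm_sq, ← opSeminorm_adjoint, ← p.moduleSeminorm_self]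
      exact (ofVector A ξ).adjoint.le_opSeminorm p ξ

theorem multAlg_seminorm (m : MultAlg A) :
    MultAlg.seminorm p.toSeminorm m = opSeminorm p.toSeminorm m.toAdj := by
  unfold MultAlg.seminorm opSeminorm
  simp only [p.modSeminorm_self]
  rfl

theorem modSeminorm_multMod (s : MultMod A E) :
    modSeminorm (MultAlg.seminorm p.toSeminorm) s = opSeminorm p.toSeminorm s := by
  rw [modSeminorm, multAlg_seminorm]
  change √(opSeminorm p.toSeminorm (MultAlg.toAdj (MultAlg.ofAdj (s.adjoint.comp s)))) = _
  rw [MultAlg.toAdj_ofAdj, opSeminorm_adjoint_comp_self, Real.sqrt_sq (opSeminorm_nonneg p s)]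

/-- The bound from above is submultiplicativity of p̃; the bound from below tests on the vectors of
E inside M(E), where the two seminorms agree. -/
theorem opSeminorm_leftComp (T : Adj A E E) :
    opSeminorm (MultAlg.seminorm p.toSeminorm) (leftComp A E T) = opSeminorm p.toSeminorm T := by
  have hle : ∀ s : MultMod A E, modSeminorm (MultAlg.seminorm p.toSeminorm) s ≤ 1 →
      modSeminorm (MultAlg.seminorm p.toSeminorm) ((leftComp A E T).map s) ≤
        opSeminorm p.toSeminorm T := fun s hs => by
    rw [modSeminorm_multMod] at hs ⊢
    exact (opSeminorm_comp_le p T s).trans (mul_le_of_le_one_right (opSeminorm_nonneg p T) hs)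
  have hb : BddAbove {r : ℝ | ∃ s : MultMod A E, modSeminorm (MultAlg.seminorm p.toSeminorm) s ≤ 1 ∧
      r = modSeminorm (MultAlg.seminorm p.toSeminorm) ((leftComp A E T).map s)} :=
    ⟨_, by rintro _ ⟨s, hs, rfl⟩; exact hle s hs⟩
  apply le_antisymm
  · refine csSup_le ⟨_, 0, ?_, rfl⟩ (by rintro _ ⟨s, hs, rfl⟩; exact hle s hs)
    rw [modSeminorm_multMod, opSeminorm_zero]
    exact zero_le_one
  · refine opSeminorm_le p T fun ξ hξ => ?_
    refine le_csSup hb ⟨ofVector A ξ, ?_, ?_⟩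
    · rwa [modSeminorm_multMod, opSeminorm_ofVector]
    · rw [modSeminorm_multMod, ← opSeminorm_ofVector, ← comp_ofVector]
      rfl

end Seminorms

theorem leftComp_injective : Function.Injective (leftComp A E) := fun S T h => by
  refine ext_map_of_isHilbertModule fun ξ => ofVector_injective (A := A) ?_
  have h1 : S.comp (ofVector A ξ) = T.comp (ofVector A ξ) := by
    rw [← leftComp_map, h, leftComp_map]
  refine ext_map_of_isHilbertModule fun a => ?_
  rw [ofVector_map, ofVector_map, ← S.map_act, ← T.map_act]
  exact congrArg (fun s : MultMod A E => s.map a) h1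

/-- Adjointable operators on `M(E)` leave `E` invariant. -/
theorem exists_map_ofVector (T : Adj (MultAlg A) (MultMod A E) (MultMod A E)) (ξ : E) :
    ∃ η : E, T.map (ofVector A ξ) = ofVector A η := by
  set s : MultMod A E := T.map (ofVector A ξ) with hs
  set r : MultMod A E := T.adj s with hr
  -- Evaluate ⟨s,s⟩ = ⟨ξ,r⟩ at a to get ⟨sa, sa⟩ = ⟨ξa, ra⟩: s(a) is small when ξa is small and a
  -- stays bounded.
  have hb : ∀ (p : ContCStarSeminorm A) (a : A), p.moduleSeminorm E (s.map a) ≤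
      √(p.moduleSeminorm E (act ξ a) * (opSeminorm p.toSeminorm r * p.toSeminorm a)) :=
    fun p a => by
    refine Real.le_sqrt_of_sq_le ?_
    have h1 : (ip s s : MultAlg A) = ip (ofVector A ξ) r := T.ip_map (ofVector A ξ) s
    have h2 : s.adj (s.map a) = ip ξ (r.map a) := congrArg (fun m : MultAlg A => m.l a) h1
    have h3 : (ip (s.map a) (s.map a) : A) = ip (act ξ a) (r.map a) := by
      rw [s.ip_map, h2, act_ip]; rfl
    rw [p.moduleSeminorm_sq, h3]
    refine (p.norm_ip_le _ _).trans (mul_le_mul_of_nonneg_left ?_ (apply_nonneg _ _))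
    rw [← p.moduleSeminorm_self]
    exact r.le_opSeminorm p a
  choose u hu2 hu using fun n : ℕ => IsHilbertModule.exists_approx_unit A ξ
    (ε := 1 / ((n : ℝ) + 1)) Nat.one_div_pos_of_nat
  have hlim := tendsto_one_div_add_atTop_nhds_zero_nat (𝕜 := ℝ)
  obtain ⟨η, hη⟩ := IsHilbertModule.complete (A := A) (Filter.map (fun n => s.map (u n)) atTop)
    inferInstance (by
      rintro _ ⟨p, rfl⟩ ε hε
      set R := opSeminorm p.toSeminorm r with hR
      have hR0 : 0 ≤ R := opSeminorm_nonneg p r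
      -- The 4 bounds p(uₘ - uₙ), as p(uₙ) ≤ 2; the sum bounds p̄(ξ(uₘ - uₙ)).
      have ht : Tendsto (fun n : ℕ => √((1 / ((n : ℝ) + 1) + 1 / ((n : ℝ) + 1)) * (R * 4)))
          atTop (𝓝 0) := by
        have := ((hlim.add hlim).mul_const (R * 4)).sqrt
        simpa using this
      obtain ⟨N, hN⟩ := (ht.eventually (gt_mem_nhds hε)).exists
      refine ⟨_, image_mem_map (Ici_mem_atTop N), ?_⟩
      rintro _ ⟨m, hm, rfl⟩ _ ⟨n, hn, rfl⟩
      change p.moduleSeminorm E (s.map (u m) - s.map (u n)) < ε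
      rw [← map_sub]
      refine (hb p _).trans_lt (lt_of_le_of_lt (Real.sqrt_le_sqrt ?_) hN)
      have h1 : p.toSeminorm (u m - u n) ≤ 4 :=
        (map_sub_le_add _ _ _).trans (by linarith [hu2 m p, hu2 n p])
      have h2 : p.moduleSeminorm E (act ξ (u m - u n)) ≤
          1 / ((N : ℝ) + 1) + 1 / ((N : ℝ) + 1) := by
        have : act ξ (u m - u n) = (ξ - act ξ (u n)) - (ξ - act ξ (u m)) := by
          rw [act_sub]; abel
        rw [this]
        refine (map_sub_le_add _ _ _).trans (add_le_add ((hu n p).trans ?_) ((hu m p).trans ?_))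
        · exact Nat.one_div_le_one_div hn
        · exact Nat.one_div_le_one_div hm
      exact mul_le_mul h2 (mul_le_mul_of_nonneg_left h1 hR0)
        (mul_nonneg hR0 (apply_nonneg _ _)) (by positivity))
  refine ⟨η, ext_map_of_isHilbertModule fun a => ?_⟩
  rw [← sub_eq_zero, ofVector_map]
  refine IsHilbertModule.eq_zero_of_seminorm A fun p => le_antisymm ?_ (apply_nonneg _ _)
  set R := opSeminorm p.toSeminorm r with hR
  have hR0 : 0 ≤ R := opSeminorm_nonneg p r
  set q := p.toSeminorm a with hq
  have hq0 : 0 ≤ q := apply_nonneg _ _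
  have hηt : Tendsto (fun n => p.moduleSeminorm E (s.map (u n) - η)) atTop (𝓝 0) := by
    rw [Metric.tendsto_nhds]
    intro ε hε
    have := hη _ ⟨p, rfl⟩ ε hε
    rw [eventually_map] at this
    filter_upwards [this] with n hn
    rw [Real.dist_0_eq_abs, abs_of_nonneg (apply_nonneg _ _)]
    exact hn
  have ht : Tendsto (fun n : ℕ => √((1 / ((n : ℝ) + 1) * q) * (R * (3 * q))) +
      p.moduleSeminorm E (s.map (u n) - η) * q) atTop (𝓝 0) := by
    have := ((hlim.mul_const q).mul_const (R * (3 * q))).sqrt.add (hηt.mul_const q)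
    simpa using this
  refine ge_of_tendsto' ht fun n => ?_
  -- The first term is small by `hb`, because ξ(a - uₙa) = (ξ - ξuₙ)a and p(a - uₙa) ≤ 3 p(a); the
  -- second because s(uₙ) tends to η.
  have h1 : s.map a - act η a = s.map (a - u n * a) + act (s.map (u n) - η) a := by
    rw [sub_act, map_sub, ← s.map_act]
    change _ = s.map a - s.map (u n * a) + (s.map (u n * a) - act η a)
    abel
  rw [h1]
  refine (map_add_le_add _ _ _).trans (add_le_add ((hb p _).trans (Real.sqrt_le_sqrt ?_))
    (p.moduleSeminorm_act_le _ _))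
  have h2 : p.toSeminorm (a - u n * a) ≤ 3 * q := by
    refine (map_sub_le_add _ _ _).trans ?_
    have := (p.mul_le (u n) a).trans (mul_le_mul_of_nonneg_right (hu2 n p) hq0)
    linarith
  have h3 : p.moduleSeminorm E (act ξ (a - u n * a)) ≤ 1 / ((n : ℝ) + 1) * q := by
    rw [act_sub, act_mul, ← sub_act]
    exact (p.moduleSeminorm_act_le _ _).trans (mul_le_mul_of_nonneg_right (hu n p) hq0)
  exact mul_le_mul h3 (mul_le_mul_of_nonneg_left h2 hR0)
    (mul_nonneg hR0 (apply_nonneg _ _)) (by positivity)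

/-- The restrictions f and g of T and T* to E form an adjointable operator on E. -/
theorem leftComp_surjective : Function.Surjective (leftComp A E) := fun T => by
  have hlin : ∀ T : Adj (MultAlg A) (MultMod A E) (MultMod A E), ∃ f : E →ₗ[ℂ] E,
      ∀ ξ, T.map (ofVector A ξ) = ofVector A (f ξ) := fun T => by
    choose f hf using exists_map_ofVector T
    refine ⟨{ toFun := f, map_add' := fun ξ η => ?_, map_smul' := fun c ξ => ?_ }, hf⟩
    · apply ofVector_injective (A := A)
      rw [ofVector_add, ← hf, ← hf, ← hf, ofVector_add, map_add]
    · apply ofVector_injective (A := A)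
      rw [RingHom.id_apply, ofVector_smul, ← hf, ← hf, ofVector_smul, map_smul]
  have hact : ∀ (T : Adj (MultAlg A) (MultMod A E) (MultMod A E)) (f : E →ₗ[ℂ] E),
      (∀ ξ, T.map (ofVector A ξ) = ofVector A (f ξ)) → ∀ ξ (a : A), f (act ξ a) = act (f ξ) a :=
    fun T f hf ξ a => by
    apply ofVector_injective (A := A)
    rw [← hf, ofVector_act, T.map_act, hf, ← ofVector_act]
  obtain ⟨f, hf⟩ := hlin T
  obtain ⟨g, hg⟩ := hlin T.adjoint
  refine ⟨{ map := f, adj := g, map_act := hact T f hf, adj_act := hact T.adjoint g hg,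
            ip_map := fun ξ η => ?_ }, ?_⟩
  · refine IsHilbertModule.eq_of_act A fun a => ?_
    have h1 := T.ip_map (ofVector A ξ) (ofVector A η)
    rw [hf, ← adjoint_map, hg] at h1
    have h2 : (ip (f ξ) (act η a) : A) = ip ξ (act (g η) a) :=
      congrArg (fun m : MultAlg A => m.l a) h1
    rwa [ip_act, ip_act] at h2
  -- Both operators agree on E, hence on M(E): (Ts)a = T(sa) with sa in E.
  · refine ext_map multMod_definite fun s => ?_
    refine ext_map_of_isHilbertModule fun a => ?_
    apply ofVector_injective (A := A)
    rw [← act_ofVector (T.map s), ← T.map_act, act_ofVector, hf]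
    rfl

end LocallyCStar

end Adj

/-! ### The topology of L_A(E, F) and the homeomorphism. -/

namespace Adj

variable {A E F : Type*} [NonUnitalRing A] [StarRing A] [Module ℂ A]
    [IsScalarTower ℂ A A] [SMulCommClass ℂ A A] [StarModule ℂ A] [UniformSpace A]
    [LocallyCStarAlgebra A]
    [AddCommGroup E] [Module ℂ E] [InnerModule A E] [IsHilbertModule A E]
    [AddCommGroup F] [Module ℂ F] [InnerModule A F] [IsHilbertModule A F]

/-- A subbasic ball containing T also contains a ball centred at T, by the triangle inequality. -/
theorem tendsto_nhds_iff {X : Type*} {l : Filter X} {f : X → Adj A E F} {T : Adj A E F} :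
    Tendsto f l (𝓝 T) ↔ ∀ p : ContCStarSeminorm A,
      Tendsto (fun x => opSeminorm p.toSeminorm (f x - T)) l (𝓝 0) := by
  refine TopologicalSpace.tendsto_nhds_generateFrom_iff.trans ⟨fun h p => ?_, ?_⟩
  · rw [Metric.tendsto_nhds]
    intro ε hε
    have := h {S | opSeminorm p.toSeminorm (S - T) < ε} ⟨_, ⟨p, rfl⟩, T, ε, rfl⟩
      (by
        change opSeminorm p.toSeminorm (T - T) < ε
        rwa [sub_self, opSeminorm_zero])
    filter_upwards [this] with x hx
    rw [Real.dist_0_eq_abs, abs_of_nonneg (opSeminorm_nonneg p _)]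
    exact hx
  · rintro h _ ⟨_, ⟨p, rfl⟩, S, ε, rfl⟩ hT
    have hT' : opSeminorm p.toSeminorm (T - S) < ε := hT
    filter_upwards [(h p).eventually (gt_mem_nhds (sub_pos.2 hT'))] with x hx
    change opSeminorm p.toSeminorm (f x - S) < ε
    rw [← sub_add_sub_cancel (f x) T S]
    exact (opSeminorm_add_le p _ _).trans_lt (lt_sub_iff_add_lt.1 hx)

theorem tendsto_opSeminorm_sub {X : Type*} [TopologicalSpace X] {f : X → Adj A E F} {x : X}
    (hf : ContinuousAt f x) (p : ContCStarSeminorm A) :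
    Tendsto (fun y => opSeminorm p.toSeminorm (f y - f x)) (𝓝 x) (𝓝 0) :=
  tendsto_nhds_iff.1 hf p

instance : ContinuousAdd (Adj A E F) where
  continuous_add := continuous_iff_continuousAt.2 fun q => tendsto_nhds_iff.2 fun p => by
    have h1 := tendsto_opSeminorm_sub (f := Prod.fst) (continuousAt_fst (p := q)) p
    have h2 := tendsto_opSeminorm_sub (f := Prod.snd) (continuousAt_snd (p := q)) p
    have h3 := h1.add h2
    rw [add_zero] at h3
    refine squeeze_zero (fun _ => opSeminorm_nonneg p _) (fun r => ?_) h3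
    rw [add_sub_add_comm]
    exact opSeminorm_add_le p _ _

instance : ContinuousConstSMul ℂ (Adj A E F) where
  continuous_const_smul c := continuous_iff_continuousAt.2 fun T => tendsto_nhds_iff.2 fun p => by
    have h1 := (tendsto_opSeminorm_sub (continuousAt_id (x := T)) p).const_mul ‖c‖
    rw [mul_zero] at h1
    refine squeeze_zero (fun _ => opSeminorm_nonneg p _) (fun r => ?_) h1
    rw [← smul_sub]
    exact opSeminorm_smul_le p _ _

instance : ContinuousStar (Adj A E E) where
  continuous_star := continuous_iff_continuousAt.2 fun T => tendsto_nhds_iff.2 fun p => by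
    have h1 := tendsto_opSeminorm_sub (continuousAt_id (x := T)) p
    refine squeeze_zero (fun _ => opSeminorm_nonneg p _) (fun r => ?_) h1
    rw [← star_sub]
    exact (opSeminorm_adjoint p _).le

instance : ContinuousMul (Adj A E E) where
  continuous_mul := continuous_iff_continuousAt.2 fun q => tendsto_nhds_iff.2 fun p => by
    have h1 := tendsto_opSeminorm_sub (f := Prod.fst) (continuousAt_fst (p := q)) p
    have h2 := tendsto_opSeminorm_sub (f := Prod.snd) (continuousAt_snd (p := q)) p
    have h3 := ((h1.mul h2).add (h2.const_mul (opSeminorm p.toSeminorm q.1))).add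
      (h1.mul_const (opSeminorm p.toSeminorm q.2))
    simp only [mul_zero, zero_mul, add_zero] at h3
    refine squeeze_zero (fun _ => opSeminorm_nonneg p _) (fun r => ?_) h3
    have : r.1 * r.2 - q.1 * q.2 =
        (r.1 - q.1) * (r.2 - q.2) + q.1 * (r.2 - q.2) + (r.1 - q.1) * q.2 := by noncomm_ring
    rw [this]
    refine (opSeminorm_add_le p _ _).trans (add_le_add ((opSeminorm_add_le p _ _).trans
      (add_le_add ?_ ?_)) ?_) <;> exact opSeminorm_comp_le p _ _

/-- Subbasic balls correspond under the isometry. Surjectivity ensures that the centre of every ball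
in the target is an image. -/
theorem isInducing_leftComp : IsInducing (leftComp A E) := by
  constructor
  refine Eq.trans ?_ induced_generateFrom_eq.symm
  change TopologicalSpace.generateFrom _ = _
  congr 1
  ext U
  constructor
  · rintro ⟨_, ⟨p, rfl⟩, T, ε, rfl⟩
    refine ⟨_, ⟨_, ⟨p, rfl⟩, leftComp A E T, ε, rfl⟩, ?_⟩
    ext S
    change opSeminorm (MultAlg.seminorm p.toSeminorm) (leftComp A E S - leftComp A E T) < ε ↔
      opSeminorm p.toSeminorm (S - T) < ε
    rw [← map_sub, opSeminorm_leftComp]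
  · rintro ⟨_, ⟨_, ⟨p, rfl⟩, T, ε, rfl⟩, rfl⟩
    obtain ⟨T, rfl⟩ := leftComp_surjective T
    refine ⟨_, ⟨p, rfl⟩, T, ε, ?_⟩
    ext S
    change opSeminorm (MultAlg.seminorm p.toSeminorm) (leftComp A E S - leftComp A E T) < ε ↔
      opSeminorm p.toSeminorm (S - T) < ε
    rw [← map_sub, opSeminorm_leftComp]

theorem isHomeomorph_leftComp : IsHomeomorph (leftComp A E) :=
  ((Equiv.ofBijective _ ⟨leftComp_injective, leftComp_surjective⟩).toHomeomorphOfIsInducing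
    isInducing_leftComp).isHomeomorph

end Adj

/-! ### Closed spans as `*`-subalgebras. -/

section SpanClosure

theorem mul_mem_span {L : Type*} [NonUnitalRing L] [Module ℂ L] [SMulCommClass ℂ L L] {G : Set L}
    {k x : L} (h : ∀ a ∈ G, k * a ∈ G) (hx : x ∈ Submodule.span ℂ G) :
    k * x ∈ Submodule.span ℂ G := by
  induction hx using Submodule.span_induction with
  | mem a ha => exact Submodule.subset_span (h a ha)
  | zero => rw [mul_zero]; exact Submodule.zero_mem _
  | add a b _ _ ha hb => rw [mul_add]; exact Submodule.add_mem _ ha hb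
  | smul c a _ ha => rw [mul_smul_comm]; exact Submodule.smul_mem _ _ ha

variable {L : Type*} [Ring L] [StarRing L] [Module ℂ L] [IsScalarTower ℂ L L]
  [SMulCommClass ℂ L L] [StarModule ℂ L] [TopologicalSpace L] [ContinuousAdd L]
  [ContinuousMul L] [ContinuousStar L] [ContinuousConstSMul ℂ L]

/-- The closed linear span of a set that is closed under products and adjoints. -/
def closedSpan (G : Set L) (hmul : ∀ a ∈ G, ∀ b ∈ G, a * b ∈ G) (hstar : ∀ a ∈ G, star a ∈ G) :
    NonUnitalStarSubalgebra ℂ L where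
  carrier := closure (Submodule.span ℂ G : Set L)
  add_mem' ha hb := (Submodule.span ℂ G).topologicalClosure.add_mem ha hb
  zero_mem' := (Submodule.span ℂ G).topologicalClosure.zero_mem
  smul_mem' c _ ha := (Submodule.span ℂ G).topologicalClosure.smul_mem c ha
  mul_mem' ha hb := map_mem_closure₂ continuous_mul ha hb fun a ha b hb => by
    induction ha using Submodule.span_induction with
    | mem a ha => exact mul_mem_span (hmul a ha) hb
    | zero => rw [zero_mul]; exact Submodule.zero_mem _
    | add a a' _ _ ha ha' => rw [add_mul]; exact Submodule.add_mem _ ha ha'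
    | smul c a _ ha => rw [smul_mul_assoc]; exact Submodule.smul_mem _ _ ha
  star_mem' ha := map_mem_closure continuous_star ha fun a ha => by
    induction ha using Submodule.span_induction with
    | mem a ha => exact Submodule.subset_span (hstar a ha)
    | zero => rw [star_zero]; exact Submodule.zero_mem _
    | add a b _ _ ha hb => rw [star_add]; exact Submodule.add_mem _ ha hb
    | smul c a _ ha => rw [star_smul]; exact Submodule.smul_mem _ _ ha

end SpanClosure

/-! ### Compact operators on E and on M(E). -/

namespace Adj

section

variable {A E F G : Type*} [NonUnitalRing A] [StarRing A] [Module ℂ A]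
  [AddCommGroup E] [Module ℂ E] [InnerModule A E]
  [AddCommGroup F] [Module ℂ F] [InnerModule A F]
  [AddCommGroup G] [Module ℂ G] [InnerModule A G]

theorem comp_rankOne (T : Adj A F G) (η : F) (ξ : E) :
    T.comp (rankOne (A := A) η ξ) = rankOne (A := A) (T.map η) ξ := by
  ext ζ
  · exact T.map_act η _
  · change act ξ (ip η (T.adj ζ) : A) = act ξ (ip (T.map η) ζ : A)
    rw [T.ip_map]

end

variable (A E : Type*) [NonUnitalRing A] [StarRing A] [Module ℂ A]
    [IsScalarTower ℂ A A] [SMulCommClass ℂ A A] [StarModule ℂ A] [UniformSpace A]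
    [LocallyCStarAlgebra A]
    [AddCommGroup E] [Module ℂ E] [InnerModule A E] [IsHilbertModule A E]

/-- `K_A(E)` as a `*`-subalgebra of `L_A(E)`. -/
def compactSubalgebra : NonUnitalStarSubalgebra ℂ (Adj A E E) :=
  closedSpan {T : Adj A E E | ∃ η ξ : E, T = rankOne η ξ}
    (by rintro _ ⟨η, ξ, rfl⟩ _ ⟨η', ξ', rfl⟩; exact ⟨_, ξ', comp_rankOne _ η' ξ'⟩)
    (by rintro _ ⟨η, ξ, rfl⟩; exact ⟨ξ, η, rfl⟩)

/-- The closed linear span of the operators `s t*` on `E` with `s, t ∈ M(E)`. -/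
def multCompactSubalgebra : NonUnitalStarSubalgebra ℂ (Adj A E E) :=
  closedSpan {T : Adj A E E | ∃ s t : MultMod A E, T = s.comp t.adjoint}
    (by
      rintro _ ⟨s, t, rfl⟩ _ ⟨s', t', rfl⟩
      exact ⟨(s.comp t.adjoint).comp s', t', rfl⟩)
    (by rintro _ ⟨s, t, rfl⟩; exact ⟨t, s, rfl⟩)

theorem compactSubalgebra_le : compactSubalgebra A E ≤ multCompactSubalgebra A E := by
  refine closure_mono (Submodule.span_mono ?_)
  rintro _ ⟨η, ξ, rfl⟩
  exact ⟨ofVector A η, ofVector A ξ, (ofVector_comp_adjoint η ξ).symm⟩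

variable {A E}

/-- Here k is any adjointable operator, since k θ_{η,ξ} = θ_{kη,ξ}. -/
theorem mul_mem_compactSubalgebra (k : Adj A E E) {x : Adj A E E}
    (hx : x ∈ compactSubalgebra A E) : k * x ∈ compactSubalgebra A E := by
  refine map_mem_closure (continuous_const_mul k) hx fun a ha => mul_mem_span ?_ ha
  rintro _ ⟨η, ξ, rfl⟩
  exact ⟨_, ξ, comp_rankOne k η ξ⟩

theorem mul_mem_compactSubalgebra_right (k : Adj A E E) {x : Adj A E E}
    (hx : x ∈ compactSubalgebra A E) : x * k ∈ compactSubalgebra A E := by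
  rw [← star_mem_iff, star_mul]
  exact mul_mem_compactSubalgebra _ (star_mem hx)

/-- Apply k θ_{ξ,kξ} = 0 to kξ: then kξ⟨kξ,kξ⟩ = 0, so ⟨kξ,kξ⟩² = 0. -/
theorem eq_zero_of_mul_compactSubalgebra {k : Adj A E E}
    (h : ∀ x ∈ compactSubalgebra A E, k * x = 0) : k = 0 := by
  refine ext_map_of_isHilbertModule fun ξ => ?_
  have h1 := h _ (subset_closure (Submodule.subset_span ⟨ξ, k.map ξ, rfl⟩))
  have h2 : act (k.map ξ) (ip (k.map ξ) (k.map ξ) : A) = 0 := by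
    rw [← k.map_act]
    exact congrArg (fun T : Adj A E E => T.map (k.map ξ)) h1
  refine (IsHilbertModule.ip_self_eq_zero (A := A) _).1 ?_
  refine (IsHilbertModule.ip_self_eq_zero (A := A) (ip (k.map ξ) (k.map ξ) : A)).1 ?_
  change star (ip (k.map ξ) (k.map ξ) : A) * ip (k.map ξ) (k.map ξ) = 0
  rw [star_ip_self, ← ip_act, h2, ip_zero]

theorem eq_zero_of_compactSubalgebra_mul {k : Adj A E E}
    (h : ∀ x ∈ compactSubalgebra A E, x * k = 0) : k = 0 := by
  rw [← star_eq_zero]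
  refine eq_zero_of_mul_compactSubalgebra fun x hx => ?_
  rw [← star_eq_zero, star_mul, star_star]
  exact h _ (star_mem hx)

/-- A linear homeomorphism commutes with closed spans, and it carries the generators s t* to
θ_{s,t}. Thus K_{M(A)}(M(E)) is a `*`-subalgebra as the image of one. -/
theorem coe_map_multCompactSubalgebra :
    ((multCompactSubalgebra A E).map (leftComp A E) : Set _) =
      compactOperators (MultAlg A) (MultMod A E) := by
  rw [NonUnitalStarSubalgebra.coe_map]
  change leftComp A E '' closure _ = _
  rw [isHomeomorph_leftComp.image_closure]
  have himage : leftComp A E '' {T : Adj A E E | ∃ s t : MultMod A E, T = s.comp t.adjoint} =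
      {T | ∃ s t : MultMod A E, T = rankOne (A := MultAlg A) s t} := by
    ext T
    constructor
    · rintro ⟨_, ⟨s, t, rfl⟩, rfl⟩
      exact ⟨s, t, leftComp_comp_adjoint s t⟩
    · rintro ⟨s, t, rfl⟩
      exact ⟨_, ⟨s, t, rfl⟩, leftComp_comp_adjoint s t⟩
  have hspan := congrArg SetLike.coe (Submodule.map_span
    (leftComp A E : Adj A E E →ₗ[ℂ] Adj (MultAlg A) (MultMod A E) (MultMod A E))
    {T : Adj A E E | ∃ s t : MultMod A E, T = s.comp t.adjoint})
  rw [Submodule.map_coe] at hspan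
  refine congrArg closure (hspan.trans ?_)
  rw [← himage]
  rfl

end Adj

/-! ### The essential ideal. -/

theorem corollary4p3 {A E : Type*} [NonUnitalRing A] [StarRing A] [Module ℂ A]
    [IsScalarTower ℂ A A] [SMulCommClass ℂ A A] [StarModule ℂ A] [UniformSpace A]
    [LocallyCStarAlgebra A] [AddCommGroup E] [Module ℂ E] [InnerModule A E]
    [IsHilbertModule A E] :
    ∃ (K : NonUnitalStarSubalgebra ℂ (Adj A E E))
      (K' I : NonUnitalStarSubalgebra ℂ (Adj (MultAlg A) (MultMod A E) (MultMod A E))),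
      (K : Set (Adj A E E)) = compactOperators A E ∧
      (K' : Set (Adj (MultAlg A) (MultMod A E) (MultMod A E))) =
        compactOperators (MultAlg A) (MultMod A E) ∧
      IsEssentialIdeal I K' ∧
      ∃ φ : K ≃⋆ₐ[ℂ] I, Continuous φ ∧ Continuous φ.symm := by
  let L := Adj.leftComp A E
  have hinj : Function.Injective L := Adj.leftComp_injective
  let K := Adj.compactSubalgebra A E
  let f : K →⋆ₙₐ[ℂ] K.map L := NonUnitalStarAlgHom.codRestrict
    (L.comp (NonUnitalStarSubalgebraClass.subtype K)) (K.map L) fun x => ⟨x, x.2, rfl⟩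
  have hf : Function.Bijective f := by
    refine ⟨fun x y h => Subtype.ext (hinj (congrArg Subtype.val h)), ?_⟩
    rintro ⟨_, x, hx, rfl⟩
    exact ⟨⟨x, hx⟩, rfl⟩
  -- Both sides carry subspace topologies, so this reduces to the corresponding property of
  -- `leftComp`.
  have hfi : IsInducing f :=
    IsInducing.of_comp_iff IsInducing.subtypeVal |>.1
      (Adj.isInducing_leftComp.comp IsInducing.subtypeVal)
  refine ⟨K, (Adj.multCompactSubalgebra A E).map L, K.map L, rfl,
    Adj.coe_map_multCompactSubalgebra, ?_, StarAlgEquiv.ofBijective f hf, hfi.continuous, ?_⟩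
  · refine ⟨NonUnitalStarSubalgebra.map_mono (Adj.compactSubalgebra_le A E),
      Adj.isHomeomorph_leftComp.isClosedMap _ isClosed_closure, ?_, ?_, ?_, ?_⟩
    · rintro _ ⟨k, -, rfl⟩ _ ⟨x, hx, rfl⟩
      exact ⟨k * x, Adj.mul_mem_compactSubalgebra k hx, map_mul L k x⟩
    · rintro _ ⟨k, -, rfl⟩ _ ⟨x, hx, rfl⟩
      exact ⟨x * k, Adj.mul_mem_compactSubalgebra_right k hx, map_mul L x k⟩
    · rintro _ ⟨k, -, rfl⟩ h
      refine (congrArg L (Adj.eq_zero_of_mul_compactSubalgebra fun x hx => hinj ?_)).trans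
        (map_zero L)
      rw [map_mul, map_zero]
      exact h _ ⟨x, hx, rfl⟩
    · rintro _ ⟨k, -, rfl⟩ h
      refine (congrArg L (Adj.eq_zero_of_compactSubalgebra_mul fun x hx => hinj ?_)).trans
        (map_zero L)
      rw [map_mul, map_zero]
      exact h _ ⟨x, hx, rfl⟩
  · exact ((StarAlgEquiv.ofBijective f hf).toEquiv.toHomeomorphOfIsInducing hfi).symm.continuous
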